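/- **Setting.** Let $S$ be a finite set of object states and let $\mathcal O$ be an object specification: each $c\in S$ has a finite set of transitions $c\xrightarrow{a}c'$, with at most one transition from $c$ for each action $a$. Let $\Delta_S=\{m\in[0,1]^S:\sum_c m_c=1\}$. For $N\ge N_0$ (with $N_0\ge 1$) let a system of $N$ objects be given by probability functions $\pi^{(N)}(m,a)$, each the value at $m\in\Delta_S$ of an expression built from constants in $[0,1]$, the fractions $m_c$ and unary and binary real operations, and by an initial state $C_0^{(N)}\in S^N$. Its object transition matrix is $K^{(N)}(m)_{c,c'}=\sum_{a:\,c\xrightarrow{a}c'}\pi^{(N)}(m,a)$ for $c\ne c'$ and $K^{(N)}(m)_{c,c}=1-\sum_{a}\pi^{(N)}(m,a)$, the last sum over the actions $a$ with $c\xrightarrow{a}c'$ for some $c'\neq c$. Write $M^{(N)}(C)\in\Delta_S$ for the vector of fractions of objects of $C\in S^N$ in the various states. Assume that for every $C\in S^N$ and $c\in S$ the values $\pi^{(N)}(M^{(N)}(C),a)$ of the actions $a$ enabled in $c$ are nonnegative with sum at most $1$. Let $X^{(N)}$ be the Markov chain on $S^N$ started in $C_0^{(N)}$ with transition probabilities $\prod_{n=1}^N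 K^{(N)}(M^{(N)}(C))_{C_{[n]},C'_{[n]}}$, where $C_{[n]}$ is the state of the $n$-th object. Put $H^{(N)}(C)=\langle C_{[1]},M^{(N)}(C)\rangle$ and let $HD^{(N)}$ be the lumped chain on $H^{(N)}(S^N)$ started in $H^{(N)}(C_0^{(N)})$, in which the probability of a step from $H^{(N)}(C)$ to $y$ is the sum of the transition probabilities from $C$ to all $C'$ with $H^{(N)}(C')=y$. All $X^{(N)}$, $N\ge N_0$, are defined on one probability space, with an arbitrary joint distribution. A state $\langle c,m\rangle\in S\times\Delta_S$ is labelled by a given set of local atomic propositions that depends only on $c$, and by those global atomic propositions $a$ whose condition $F_a(m_{c_1},\dots,m_{c_q})\bowtie r_a$ holds, where $\bowtie\,\in\{<,>\}$, $r_a\in\mathbb R$ and $F_a$ is continuous on $[0,1]^q$ ($q$ and $c_1,\dots,c_q\in S$ depend on $a$). Time bounded PCTL formulas are $\Phi::=a\mid\neg\Phi\mid\Phi\vee\Phi\mid P_{\bowtie p}(\varphi)$ with $\varphi::=\mathbf{X}\,\Phi\mid\Phi\;\mathbf{U}^{\le k}\,\Phi$ and $\bowtie\,\in\{\ge,>,\le,<\}$,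 with their usual semantics over state labelled discrete time Markov chains. **Theorem.** Assume that: 1. there are row-stochastic matrices $K(m)$, continuous in $m\in\Delta_S$, such that $K^{(N)}(m)_{c,c'}\to K(m)_{c,c'}$ uniformly in $m\in\Delta_S$, for all $c,c'\in S$; 2. $M^{(N)}(C^{(N)}_0)\to\mu_0$ for some $\mu_0\in\Delta_S$; 3. the initial state $c_0$ of the first object does not depend on $N$. Let $\mu(0)=\mu_0$ and $\mu(s+1)=\mu(s)\cdot K(\mu(s))$. Let $HD$ be the chain on $S\times\Delta_S$ started in $\langle c_0,\mu_0\rangle$ that goes from $\langle c,m\rangle$ to $\langle c',m\cdot K(m)\rangle$ with probability $K(m)_{c,c'}$. Let $t\in\mathbb N$, and let $\Phi$ be a formula that is safe in the following sense: * for every subformula $P_{\bowtie p}(\varphi)$ of $\Phi$ and every state $\langle c,\mu(s)\rangle$ with $c\in S$ and $s\ge t$, the probability in $HD$ of the set of paths from $\langle c,\mu(s)\rangle$ satisfying $\varphi$ is different from $p$; * for every global atomic proposition $a$ occurring in $\Phi$ and every $s\ge t$, the value of $F_a$ at $\mu(s)$ is different from $r_a$. Then almost surely, for all sufficiently large $N$,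 the state $H^{(N)}(C)$ with $C=X^{(N)}(t)$ is reachable in $HD^{(N)}$ at time $t$, and $$H^{(N)}(C)\models_{HD^{(N)}}\Phi\iff\langle C_{[1]},\mu(t)\rangle\models_{HD}\Phi .$$ -/

import Mathlib

open Filter Topology MeasureTheory ProbabilityTheory

namespace MeanField

/-! ### State labelled discrete time Markov chains and time bounded PCTL -/

/-- A state labelled DTMC: one-step transition probabilities (the row of the one-step matrix at
every state is a discrete probability distribution), a labelling of the states by sets of atomic
propositions, and an initial state. -/
structure LDTMC (S : Type*) (AP : Type*) where
  step : S → PMF S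
  label : S → Set AP
  start : S

/-- The comparisons `≥, >, ≤, <`. -/
inductive Cmp
  | ge | gt | le | lt

/-- Meaning of a comparison. -/
def Cmp.Holds : Cmp → ℝ → ℝ → Prop
  | .ge, x, y => x ≥ y
  | .gt, x, y => x > y
  | .le, x, y => x ≤ y
  | .lt, x, y => x < y

/-- Time bounded PCTL formulae. A path formula (`X Φ` or `Φ₁ U^{≤ k} Φ₂`) occurs only directly
below a probability operator, so the two forms of `P_{⋈ p}(φ)` are two constructors. -/
inductive Formula (AP : Type*)
  | atom (a : AP)
  | neg (Φ : Formula AP)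
  | or (Φ₁ Φ₂ : Formula AP)
  | probNext (r : Cmp) (p : ℝ) (Φ : Formula AP)
  | probUntil (r : Cmp) (p : ℝ) (k : ℕ) (Φ₁ Φ₂ : Formula AP)

/-- The atomic propositions that occur in a formula. -/
def Formula.atoms {AP : Type*} : Formula AP → Set AP
  | .atom a => {a}
  | .neg Φ => Φ.atoms
  | .or Φ₁ Φ₂ => Φ₁.atoms ∪ Φ₂.atoms
  | .probNext _ _ Φ => Φ.atoms
  | .probUntil _ _ _ Φ₁ Φ₂ => Φ₁.atoms ∪ Φ₂.atoms

/-- The sequences of states that satisfy `X Φ`, where `A` is the set of states satisfying `Φ`. -/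
def nextEvent {S : Type*} (A : Set S) : Set (ℕ → S) :=
  {σ | σ 1 ∈ A}

/-- The sequences of states that satisfy `Φ₁ U^{≤ k} Φ₂`, where `A`, `B` are the sets of states
satisfying `Φ₁`, `Φ₂`. -/
def untilEvent {S : Type*} (A B : Set S) (k : ℕ) : Set (ℕ → S) :=
  {σ | ∃ h ≤ k, σ h ∈ B ∧ ∀ i < h, σ i ∈ A}

/-- The σ-algebra on sequences of states generated by the cylinder sets
`{σ | σ i ∈ A}`, `A` an arbitrary set of states. -/
abbrev cylinderSigma (S : Type*) : MeasurableSpace (ℕ → S) :=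
  @MeasurableSpace.pi ℕ (fun _ => S) (fun _ => ⊤)

namespace LDTMC

variable {S AP : Type*}

/-- The infinite paths from `s`. -/
def paths (M : LDTMC S AP) (s : S) : Set (ℕ → S) :=
  {σ | σ 0 = s ∧ ∀ i, 0 < M.step (σ i) (σ (i + 1))}

/-- The states reachable in exactly `t` steps from the initial state. -/
def reach (M : LDTMC S AP) (t : ℕ) : Set S :=
  {s | ∃ σ ∈ M.paths M.start, σ t = s}

/-- The kernel that gives the law of state `n + 1` given the states `0, …, n`. -/
noncomputable def stepKernel (M : LDTMC S AP) [MeasurableSpace S] [DiscreteMeasurableSpace S]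
    (n : ℕ) : Kernel ((i : Finset.Iic n) → S) S where
  toFun x := (M.step (x ⟨n, Finset.mem_Iic.2 le_rfl⟩)).toMeasure
  measurable' :=
    (Measurable.of_discrete (f := fun s : S => (M.step s).toMeasure)).comp
      (measurable_pi_apply _)

instance (M : LDTMC S AP) [MeasurableSpace S] [DiscreteMeasurableSpace S] (n : ℕ) :
    IsMarkovKernel (M.stepKernel n) :=
  ⟨fun x => PMF.toMeasure.isProbabilityMeasure (M.step (x ⟨n, Finset.mem_Iic.2 le_rfl⟩))⟩

/-- The law, on sequences of states, of the Markov chain started in `s` (Ionescu-Tulcea). -/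
noncomputable def pathMeasure (M : LDTMC S AP) (s : S) : @Measure (ℕ → S) (cylinderSigma S) :=
  letI : MeasurableSpace S := ⊤
  haveI : DiscreteMeasurableSpace S := ⟨fun _ => trivial⟩
  Kernel.traj (X := fun _ => S) M.stepKernel 0 (fun _ => s)

/-- The probability that the path of the chain started in `s` lies in `E`. (The law of the chain
gives mass one to the paths from `s`, so nothing else has to be said about `E`.) -/
noncomputable def pr (M : LDTMC S AP) (s : S) (E : Set (ℕ → S)) : ℝ :=
  (M.pathMeasure s E).toReal

/-- The satisfaction relation of time bounded PCTL. -/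
def Sat (M : LDTMC S AP) : Formula AP → S → Prop
  | .atom a, s => a ∈ M.label s
  | .neg Φ, s => ¬ M.Sat Φ s
  | .or Φ₁ Φ₂, s => M.Sat Φ₁ s ∨ M.Sat Φ₂ s
  | .probNext r p Φ, s => r.Holds (M.pr s (nextEvent {s' | M.Sat Φ s'})) p
  | .probUntil r p k Φ₁ Φ₂, s =>
      r.Holds (M.pr s (untilEvent {s' | M.Sat Φ₁ s'} {s' | M.Sat Φ₂ s'} k)) p

/-- `Φ` is safe on the set of states `A`: for every subformula `P_{⋈ p}(φ)` of `Φ` and every state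
in `A`, the probability of the set of paths from that state that satisfy `φ` differs from `p`. -/
def SafeOn (M : LDTMC S AP) (A : Set S) : Formula AP → Prop
  | .atom _ => True
  | .neg Φ => M.SafeOn A Φ
  | .or Φ₁ Φ₂ => M.SafeOn A Φ₁ ∧ M.SafeOn A Φ₂
  | .probNext _ p Φ =>
      M.SafeOn A Φ ∧ ∀ s ∈ A, M.pr s (nextEvent {s' | M.Sat Φ s'}) ≠ p
  | .probUntil _ p k Φ₁ Φ₂ =>
      M.SafeOn A Φ₁ ∧ M.SafeOn A Φ₂ ∧
        ∀ s ∈ A, M.pr s (untilEvent {s' | M.Sat Φ₁ s'} {s' | M.Sat Φ₂ s'} k) ≠ p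

/-- `X` is a Markov process on the probability space `(Ω, P)` that starts in the initial state of
`M` and has the one-step transition probabilities of `M` (for a finite or countable state set). -/
structure IsRealizedBy (M : LDTMC S AP) {Ω : Type*} [MeasurableSpace Ω] (P : Measure Ω)
    (X : ℕ → Ω → S) : Prop where
  measurable : ∀ t s, MeasurableSet {ω | X t ω = s}
  start : ∀ᵐ ω ∂P, X 0 ω = M.start
  markov : ∀ (t : ℕ) (x : ℕ → S),
    P {ω | ∀ i ≤ t + 1, X i ω = x i} =
      P {ω | ∀ i ≤ t, X i ω = x i} * M.step (x t) (x (t + 1))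

end LDTMC

/-- The discrete distribution given by a row of a row-stochastic matrix. -/
noncomputable def rowPMF {S : Type*} [Fintype S] [DecidableEq S] (K : Matrix S S ℝ)
    (hK : K ∈ Matrix.rowStochastic ℝ S) (c : S) : PMF S :=
  PMF.ofFintype (fun c' => ENNReal.ofReal (K c c')) (by
    rw [← ENNReal.ofReal_sum_of_nonneg (fun c' _ => Matrix.nonneg_of_mem_rowStochastic hK),
      Matrix.sum_row_of_mem_rowStochastic hK, ENNReal.ofReal_one])

/-! ### The population language -/

/-- An object specification with (finite) set of states `S` and actions in `Act`: every state `C`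
has a definition `C := ∑ⱼ aⱼ.Cⱼ`, given by its finite set of summands `(aⱼ, Cⱼ)`, in which the
actions are pairwise distinct. -/
structure ObjectSpec (S : Type*) (Act : Type*) where
  summands : S → Finset (Act × S)
  distinct : ∀ c, ∀ x ∈ summands c, ∀ y ∈ summands c, x.1 = y.1 → x = y

/-- Expressions for action probabilities: numbers in `[0,1]`, fractions `frc C`, and arithmetic
unary and binary operators. -/
inductive Exp (S : Type*)
  | const (v : unitInterval)
  | frc (c : S)
  | unary (op : ℝ → ℝ) (e : Exp S)
  | binary (op : ℝ → ℝ → ℝ) (e₁ e₂ : Exp S)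

/-- The value of an expression at an occupancy measure. -/
def Exp.eval {S : Type*} [Fintype S] (m : stdSimplex ℝ S) : Exp S → ℝ
  | .const v => v
  | .frc c => m.1 c
  | .unary op e => op (e.eval m)
  | .binary op e₁ e₂ => op (e₁.eval m) (e₂.eval m)

section Language

variable {S Act : Type*} [Fintype S] [DecidableEq S] [DecidableEq Act]

/-- The actions `a` with `c -a→ c'`. -/
def ObjectSpec.actionsTo (Δ : ObjectSpec S Act) (c c' : S) : Finset Act :=
  ((Δ.summands c).filter (fun x => x.2 = c')).image Prod.fst

/-- The actions `a` with `c -a→ c'` for some `c' ≠ c`. -/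
def ObjectSpec.leaving (Δ : ObjectSpec S Act) (c : S) : Finset Act :=
  ((Δ.summands c).filter (fun x => x.2 ≠ c)).image Prod.fst

/-- The object transition matrix at an occupancy measure `m`, for probability function
definitions `A`. -/
def objMatrix (Δ : ObjectSpec S Act) (A : Act → Exp S) (m : stdSimplex ℝ S) : Matrix S S ℝ :=
  Matrix.of fun c c' =>
    if c ≠ c' then ∑ a ∈ Δ.actionsTo c c', (A a).eval m
    else 1 - ∑ a ∈ Δ.leaving c, (A a).eval m

/-- At `m`, the actions enabled in `c` have nonnegative values, and these values sum up to at most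
one. -/
def Probabilistic (Δ : ObjectSpec S Act) (A : Act → Exp S) (m : stdSimplex ℝ S) (c : S) : Prop :=
  (∀ a ∈ Δ.leaving c ∪ Δ.actionsTo c c, 0 ≤ (A a).eval m) ∧
    ∑ a ∈ Δ.leaving c ∪ Δ.actionsTo c c, (A a).eval m ≤ 1

theorem objMatrix_mem (Δ : ObjectSpec S Act) (A : Act → Exp S) (m : stdSimplex ℝ S)
    (h : ∀ c, Probabilistic Δ A m c) : objMatrix Δ A m ∈ Matrix.rowStochastic ℝ S := by
  have hsub : ∀ c c', c ≠ c' → Δ.actionsTo c c' ⊆ Δ.leaving c := by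
    intro c c' hc
    refine Finset.image_subset_image ?_
    intro x hx
    rw [Finset.mem_filter] at hx ⊢
    exact ⟨hx.1, fun h' => hc (h'.symm.trans hx.2)⟩
  have hnn : ∀ c, ∀ a ∈ Δ.leaving c, 0 ≤ (A a).eval m := fun c a ha =>
    (h c).1 a (Finset.mem_union_left _ ha)
  have hle : ∀ c, ∑ a ∈ Δ.leaving c, (A a).eval m ≤ 1 := fun c =>
    (Finset.sum_le_sum_of_subset_of_nonneg Finset.subset_union_left
      (fun a ha _ => (h c).1 a ha)).trans (h c).2
  rw [Matrix.mem_rowStochastic_iff_sum]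
  constructor
  · intro c c'
    simp only [objMatrix, Matrix.of_apply]
    split_ifs with hc
    · exact Finset.sum_nonneg fun a ha => hnn c a (hsub c c' hc ha)
    · linarith [hle c]
  · intro c
    have hleave : ∑ a ∈ Δ.leaving c, (A a).eval m =
        ∑ c' ∈ Finset.univ.erase c, ∑ a ∈ Δ.actionsTo c c', (A a).eval m := by
      rw [← Finset.sum_biUnion]
      · refine Finset.sum_congr ?_ fun _ _ => rfl
        ext a
        simp only [ObjectSpec.leaving, ObjectSpec.actionsTo, Finset.mem_image,
          Finset.mem_filter, Finset.mem_biUnion, Finset.mem_erase, Finset.mem_univ, and_true]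
        constructor
        · rintro ⟨x, ⟨hx, hxc⟩, rfl⟩
          exact ⟨x.2, hxc, x, ⟨hx, rfl⟩, rfl⟩
        · rintro ⟨c', hc', x, ⟨hx, rfl⟩, rfl⟩
          exact ⟨x, ⟨hx, hc'⟩, rfl⟩
      · intro c₁ _ c₂ _ hne
        simp only [Function.onFun]
        rw [Finset.disjoint_left]
        intro a h₁ h₂
        simp only [ObjectSpec.actionsTo, Finset.mem_image, Finset.mem_filter] at h₁ h₂
        obtain ⟨x, ⟨hx, hx1⟩, hxa⟩ := h₁
        obtain ⟨y, ⟨hy, hy1⟩, hya⟩ := h₂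
        have := Δ.distinct c x hx y hy (hxa.trans hya.symm)
        exact hne (hx1.symm.trans (this ▸ hy1))
    rw [← Finset.add_sum_erase _ _ (Finset.mem_univ c)]
    have : ∑ c' ∈ Finset.univ.erase c, objMatrix Δ A m c c' =
        ∑ c' ∈ Finset.univ.erase c, ∑ a ∈ Δ.actionsTo c c', (A a).eval m := by
      refine Finset.sum_congr rfl fun c' hc' => ?_
      simp only [objMatrix, Matrix.of_apply]
      rw [if_pos (Finset.ne_of_mem_erase hc').symm]
    rw [this, ← hleave]
    simp [objMatrix]

/-- The occupancy measure of a global state of `N` objects: the fractions of objects in the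
various states. -/
noncomputable def occupancy {N : ℕ+} (C : Fin N → S) : stdSimplex ℝ S :=
  ⟨fun c => (1 / ((N : ℕ) : ℝ)) * ∑ n, if C n = c then 1 else 0, by
    constructor
    · intro c
      exact mul_nonneg (by positivity) (Finset.sum_nonneg fun n _ => by split_ifs <;> norm_num)
    · rw [← Finset.mul_sum, Finset.sum_comm]
      have hN : ((N : ℕ) : ℝ) ≠ 0 := by exact_mod_cast N.ne_zero
      simp [hN]⟩

/-- A system specification of population size `N`: one probability function definition for every
action, and an initial global state. The states of the objects are required to be probabilistic at
all the occupancy measures of the system, so that its global chain exists. -/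
structure SystemSpec (Δ : ObjectSpec S Act) (N : ℕ+) where
  prob : Act → Exp S
  start : Fin N → S
  probabilistic : ∀ (C : Fin N → S) (c : S), Probabilistic Δ prob (occupancy C) c

/-! ### Labels -/

/-- A restricted boolean expression `F(frc C₁, …, frc C_q) ⋈ r` with `F` continuous on `[0,1]^q`
and `⋈` one of `>`, `<`. -/
structure BExp (S : Type*) where
  arity : ℕ
  F : (Fin arity → ℝ) → ℝ
  continuousOn : ContinuousOn F (Set.Icc 0 1)
  args : Fin arity → S
  greater : Bool
  r : ℝ

/-- The value of `F(frc C₁, …, frc C_q)` at an occupancy measure. -/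
def BExp.value (b : BExp S) (m : stdSimplex ℝ S) : ℝ :=
  b.F fun i => m.1 (b.args i)

/-- The truth value of a restricted boolean expression at an occupancy measure. -/
def BExp.Holds (b : BExp S) (m : stdSimplex ℝ S) : Prop :=
  if b.greater then b.value m > b.r else b.value m < b.r

/-- The atomic propositions true of an object in state `c` in the context `m`: the local ones that
label `c`, and the global ones whose boolean expression is true at `m`. -/
def stateLabel {AP₁ APg : Type*} (loc : S → Set AP₁) (glob : APg → BExp S)
    (x : S × stdSimplex ℝ S) : Set (AP₁ ⊕ APg) :=
  Sum.inl '' loc x.1 ∪ Sum.inr '' {a | (glob a).Holds x.2}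

/-! ### The global chain of `N` objects and its lumping -/

/-- The pair of the state of the first object and the occupancy measure. -/
noncomputable def lumpPair {N : ℕ+} (C : Fin N → S) : S × stdSimplex ℝ S :=
  (C 0, occupancy C)

namespace SystemSpec

variable {Δ : ObjectSpec S Act} {N : ℕ+}

/-- The object transition matrix of a system. -/
def otm (sys : SystemSpec Δ N) (m : stdSimplex ℝ S) : Matrix S S ℝ :=
  objMatrix Δ sys.prob m

/-- The one-step matrix of the global chain: at each step the objects move independently, each
according to the object transition matrix at the current occupancy measure. -/
noncomputable def globalMatrix (sys : SystemSpec Δ N) : Matrix (Fin N → S) (Fin N → S) ℝ :=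
  Matrix.of fun C C' => ∏ n, sys.otm (occupancy C) (C n) (C' n)

theorem otm_mem (sys : SystemSpec Δ N) (C : Fin N → S) :
    sys.otm (occupancy C) ∈ Matrix.rowStochastic ℝ S :=
  objMatrix_mem Δ sys.prob _ (sys.probabilistic C)

theorem globalMatrix_mem (sys : SystemSpec Δ N) :
    sys.globalMatrix ∈ Matrix.rowStochastic ℝ (Fin N → S) := by
  rw [Matrix.mem_rowStochastic_iff_sum]
  refine ⟨fun C C' => ?_, fun C => ?_⟩
  · simp only [globalMatrix, Matrix.of_apply]
    exact Finset.prod_nonneg fun n _ => Matrix.nonneg_of_mem_rowStochastic (sys.otm_mem C)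
  · simp only [globalMatrix, Matrix.of_apply]
    rw [← Fintype.prod_sum (fun n c' => sys.otm (occupancy C) (C n) c')]
    exact Finset.prod_eq_one fun n _ => Matrix.sum_row_of_mem_rowStochastic (sys.otm_mem C) _

/-- The state labelled DTMC of the system of `N` objects. -/
noncomputable def chain {AP₁ APg : Type*} (sys : SystemSpec Δ N) (loc : S → Set AP₁)
    (glob : APg → BExp S) : LDTMC (Fin N → S) (AP₁ ⊕ APg) where
  step := rowPMF sys.globalMatrix sys.globalMatrix_mem
  label C := stateLabel loc glob (lumpPair C)
  start := sys.start

end SystemSpec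

/-- The states of the lumped chain of `N` objects: the pairs of the state of the first object and
the occupancy measure that belong to some global state. -/
abbrev LumpState (S : Type*) [Fintype S] [DecidableEq S] (N : ℕ+) : Type _ :=
  {x : S × stdSimplex ℝ S // ∃ C : Fin N → S, lumpPair C = x}

/-- The map from global states to states of the lumped chain. -/
noncomputable def lump {N : ℕ+} (C : Fin N → S) : LumpState S N :=
  ⟨lumpPair C, C, rfl⟩

namespace SystemSpec

variable {Δ : ObjectSpec S Act} {N : ℕ+}

/-- The lumped chain: the probability of a step from `x` to `y` is the sum of the probabilities of
the steps of the global chain from `C` to the global states `C'` with `lump C' = y`, where `C` is a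
global state with `lump C = x`; see `lumped_step_lump` for the independence of `C`. -/
noncomputable def lumped {AP₁ APg : Type*} (sys : SystemSpec Δ N) (loc : S → Set AP₁)
    (glob : APg → BExp S) : LDTMC (LumpState S N) (AP₁ ⊕ APg) where
  step x := ((sys.chain loc glob).step x.2.choose).map lump
  label x := stateLabel loc glob x.1
  start := lump sys.start

/-- Two global states with the same lumping are permutations of each other that fix the first
object. -/
theorem exists_perm_of_lump_eq {C D : Fin N → S} (h : lumpPair C = lumpPair D) :
    ∃ e : Equiv.Perm (Fin N), e 0 = 0 ∧ ∀ n, D (e n) = C n := by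
  have h0 : C 0 = D 0 := congrArg Prod.fst h
  have hocc : occupancy C = occupancy D := congrArg Prod.snd h
  have hcard : ∀ c, Fintype.card {n // C n = c} = Fintype.card {n // D n = c} := by
    intro c
    have h1 := congrFun (congrArg Subtype.val hocc) c
    have hN : ((N : ℕ) : ℝ) ≠ 0 := by exact_mod_cast N.ne_zero
    simp only [occupancy] at h1
    have h2 := mul_left_cancel₀ (one_div_ne_zero hN) h1
    rw [Finset.sum_boole, Finset.sum_boole] at h2
    rw [Fintype.card_subtype, Fintype.card_subtype]
    exact_mod_cast h2
  let e₀ : Equiv.Perm (Fin N) := Equiv.ofFiberEquiv fun c => Fintype.equivOfCardEq (hcard c)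
  have he₀ : ∀ n, D (e₀ n) = C n := fun n => Equiv.ofFiberEquiv_map _ n
  refine ⟨e₀.trans (Equiv.swap (e₀ 0) 0), by simp, fun n => ?_⟩
  simp only [Equiv.trans_apply]
  rcases eq_or_ne (e₀ n) (e₀ 0) with h1 | h1
  · rw [h1, Equiv.swap_apply_left, ← h0, ← he₀ n, h1, he₀ 0]
  · rcases eq_or_ne (e₀ n) 0 with h2 | h2
    · rw [h2, Equiv.swap_apply_right, he₀ 0, h0, ← he₀ n, h2]
    · rw [Equiv.swap_apply_of_ne_of_ne h1 h2, he₀ n]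

/-- The step probabilities of the lumped chain do not depend on the chosen global state. -/
theorem lumped_step_lump {AP₁ APg : Type*} (sys : SystemSpec Δ N) (loc : S → Set AP₁)
    (glob : APg → BExp S) (C : Fin N → S) :
    (sys.lumped loc glob).step (lump C) = ((sys.chain loc glob).step C).map lump := by
  have hD : lumpPair C = lumpPair (lump C).2.choose := (lump C).2.choose_spec.symm
  change ((sys.chain loc glob).step (lump C).2.choose).map lump = _
  generalize (lump C).2.choose = D at hD
  obtain ⟨e, he0, he⟩ := exists_perm_of_lump_eq hD
  let φ : (Fin N → S) ≃ (Fin N → S) :=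
    ⟨fun C' n => C' (e n), fun C' n => C' (e.symm n), fun C' => by simp, fun C' => by simp⟩
  have hφ : ∀ C' : Fin N → S, lump (φ C') = lump C' := by
    intro C'
    refine Subtype.ext (Prod.ext ?_ (Subtype.ext (funext fun c => ?_)))
    · change C' (e 0) = C' 0
      rw [he0]
    · change _ * _ = _ * _
      congr 1
      exact Equiv.sum_comp e fun n => if C' n = c then (1 : ℝ) else 0
  have hstep : ∀ C', (sys.chain loc glob).step D C' = (sys.chain loc glob).step C (φ C') := by
    intro C'
    have hocc : occupancy C = occupancy D := congrArg Prod.snd hD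
    simp only [chain, rowPMF, PMF.ofFintype_apply, globalMatrix, Matrix.of_apply, hocc]
    congr 1
    rw [← Equiv.prod_comp e]
    exact Finset.prod_congr rfl fun n _ => by rw [he n]; rfl
  ext y
  rw [PMF.map_apply, PMF.map_apply]
  refine Eq.trans (tsum_congr fun C' => ?_) (φ.tsum_eq _)
  rw [hstep, hφ]

end SystemSpec

/-! ### The mean-field limit -/

theorem vecMul_mem_stdSimplex {K : Matrix S S ℝ} (hK : K ∈ Matrix.rowStochastic ℝ S)
    (m : stdSimplex ℝ S) : Matrix.vecMul m.1 K ∈ stdSimplex ℝ S := by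
  constructor
  · intro c
    exact Finset.sum_nonneg fun i _ => mul_nonneg (m.2.1 i) (Matrix.nonneg_of_mem_rowStochastic hK)
  · simp only [Matrix.vecMul, dotProduct]
    rw [Finset.sum_comm]
    simp_rw [← Finset.mul_sum, Matrix.sum_row_of_mem_rowStochastic hK, mul_one]
    exact m.2.2

section Limit

variable (K : stdSimplex ℝ S → Matrix S S ℝ) (hK : ∀ m, K m ∈ Matrix.rowStochastic ℝ S)

/-- One step `m ↦ m · K(m)` of the mean-field recursion. -/
def drift (m : stdSimplex ℝ S) : stdSimplex ℝ S :=
  ⟨Matrix.vecMul m.1 (K m), vecMul_mem_stdSimplex (hK m) m⟩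

/-- The mean-field trajectory: `μ(0) = μ₀`, `μ(t+1) = μ(t) · K(μ(t))`. -/
def meanField (μ₀ : stdSimplex ℝ S) : ℕ → stdSimplex ℝ S
  | 0 => μ₀
  | t + 1 => drift K hK (meanField μ₀ t)

/-- The limit chain: from `(c, m)` it goes to `(c', m · K(m))` with probability `K(m)_{c,c'}`. -/
noncomputable def limitChain {AP₁ APg : Type*} (c₀ : S) (μ₀ : stdSimplex ℝ S)
    (loc : S → Set AP₁) (glob : APg → BExp S) : LDTMC (S × stdSimplex ℝ S) (AP₁ ⊕ APg) where
  step x := (rowPMF (K x.2) (hK x.2) x.1).map fun c' => (c', drift K hK x.2)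
  label := stateLabel loc glob
  start := (c₀, μ₀)

end Limit

end Language

end MeanField

/-!
The theorem rests on two facts about large populations: the occupancy measures follow the mean field
almost surely, and bounded path probabilities are continuous in the limit of large populations.

*Almost sure convergence.* Given the global state, the objects move independently, so a Chernoff
bound (`sum_prod_le_two_mul_exp`) shows that after one step every fraction differs by `ε` from its
expectation with a probability exponentially small in `N`. As the object transition matrices
converge uniformly to a continuous limit, the expectation is close to `m · K(m)` if the current
occupancy measure is close to `m` (`exists_summable_escape`). By induction on time, the probability
that the occupancy measure at time `t` is outside a neighbourhood of `μ(t)` is summable over `N`,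
and the Borel–Cantelli lemma, which asks nothing of the joint distribution of the chains, gives
`ae_tendsto_occupancy`. A bound of order `1 / N`, such as Chebyshev's, would not suffice here.

*Transfer of satisfaction.* The limits are taken along `nearFilter N₀ m`: the population size tends
to infinity and the occupancy measure to `m`, uniformly in the global state. If near `m · K(m)` a
function on the states of the lumped chains is asymptotically a function of the state of the first
object alone, then so is its one-step expectation near `m`, and the limit is the one-step
expectation in the limit chain (`tendsto_step`). The probability of a bounded until formula is a
finite sum of iterates of a one-step operator (`LDTMC.pr_untilEvent`), so it converges along the
mean field. A limit different from the threshold `p` decides the comparison with `p` for all large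
`N`, and likewise for the global atomic propositions; induction on the formula gives
`agreeNear_sat`.
-/

namespace MeanField

open scoped ENNReal

/-! ### Path probabilities of bounded until formulae -/

/-- The expectation of a function with values in `[0, ∞]` under a discrete distribution. -/
noncomputable def pmfExp {S : Type*} (p : PMF S) (f : S → ℝ≥0∞) : ℝ≥0∞ :=
  ∑' y, p y * f y

theorem lintegral_toMeasure {S : Type*} [MeasurableSpace S] [DiscreteMeasurableSpace S]
    (p : PMF S) (f : S → ℝ≥0∞) : ∫⁻ y, f y ∂p.toMeasure = pmfExp p f := by
  have h : p.toMeasure = Measure.sum fun a => p a • Measure.dirac a := by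
    ext s hs
    rw [PMF.toMeasure_apply_eq_tsum, Measure.sum_apply _ hs]
    refine tsum_congr fun a => ?_
    by_cases ha : a ∈ s <;> simp [ha]
  rw [h, lintegral_sum_measure]
  simp [pmfExp]

theorem pmfExp_map {S T : Type*} (p : PMF S) (g : S → T) (f : T → ℝ≥0∞) :
    pmfExp (p.map g) f = pmfExp p fun x => f (g x) := by
  let : MeasurableSpace S := ⊤
  let : MeasurableSpace T := ⊤
  have : DiscreteMeasurableSpace S := ⟨fun _ => trivial⟩
  have : DiscreteMeasurableSpace T := ⟨fun _ => trivial⟩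
  rw [← lintegral_toMeasure, ← lintegral_toMeasure, ← PMF.toMeasure_map g p .of_discrete,
    lintegral_map .of_discrete .of_discrete]

theorem pmfExp_le_one {S : Type*} (p : PMF S) {f : S → ℝ≥0∞} (hf : ∀ y, f y ≤ 1) :
    pmfExp p f ≤ 1 :=
  (ENNReal.tsum_le_tsum fun y => mul_le_of_le_one_right' (hf y)).trans p.tsum_coe.le

namespace LDTMC

variable {S AP : Type*} (M : LDTMC S AP)

/-- The function whose value at `s` is the expectation of `f` after one step from `s` if `s ∈ D`,
and `0` otherwise. -/
noncomputable def stepWithin (D : Set S) (f : S → ℝ≥0∞) (s : S) : ℝ≥0∞ :=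
  D.indicator (fun s => pmfExp (M.step s) f) s

theorem stepWithin_le_one (D : Set S) {f : S → ℝ≥0∞} (hf : ∀ y, f y ≤ 1) (s : S) :
    M.stepWithin D f s ≤ 1 :=
  (Set.indicator_le_self _ _ s).trans (pmfExp_le_one _ hf)

theorem iterate_stepWithin_le_one (D : Set S) {f : S → ℝ≥0∞} (hf : ∀ y, f y ≤ 1) (h : ℕ) (s : S) :
    (M.stepWithin D)^[h] f s ≤ 1 := by
  induction h generalizing f with
  | zero => exact hf s
  | succ h ih => exact ih (M.stepWithin_le_one D hf)

/-- The iterates of `stepWithin D` give the law of the chain at time `h` restricted to the paths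
that stay in `D` before. -/
theorem lintegral_pathMeasure (D : Set S) (h : ℕ) (f : S → ℝ≥0∞) (s : S) :
    ∫⁻ σ, {σ | ∀ i < h, σ i ∈ D}.indicator (fun σ => f (σ h)) σ ∂(M.pathMeasure s) =
      (M.stepWithin D)^[h] f s := by
  let : MeasurableSpace S := ⊤
  have : DiscreteMeasurableSpace S := ⟨fun _ => trivial⟩
  change ∫⁻ σ, {σ | ∀ i < h, σ i ∈ D}.indicator (fun σ => f (σ h)) σ
    ∂(Kernel.traj (X := fun _ => S) M.stepKernel 0 (fun _ => s)) = _
  induction h generalizing f with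
  | zero =>
    have hf : Measurable fun x : (i : Finset.Iic 0) → S => f (x ⟨0, Finset.mem_Iic.2 le_rfl⟩) :=
      (Measurable.of_discrete (f := f)).comp (measurable_pi_apply _)
    have key := lintegral_map (μ := Kernel.traj (X := fun _ => S) M.stepKernel 0 (fun _ => s)) hf
      (Preorder.measurable_frestrictLe (X := fun _ => S) 0)
    rw [Kernel.traj_map_frestrictLe_apply, Kernel.partialTraj_self, Kernel.id_apply,
      lintegral_dirac' _ hf] at key
    simpa using key.symm
  | succ h ih =>
    rw [Function.iterate_succ_apply, ← ih]
    have hD : MeasurableSet {x : (i : Finset.Iic h) → S | ∀ i, x i ∈ D} := by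
      simp only [Set.ofPred_forall]
      exact MeasurableSet.iInter fun i => measurable_pi_apply i (MeasurableSet.of_discrete (s := D))
    let F : ((i : Finset.Iic h) → S) × S → ℝ≥0∞ := fun q =>
      {x : (i : Finset.Iic h) → S | ∀ i, x i ∈ D}.indicator 1 q.1 * f q.2
    have hF : Measurable F :=
      ((measurable_one.indicator hD).comp measurable_fst).mul
        ((Measurable.of_discrete (f := f)).comp measurable_snd)
    have hmeas : Measurable fun σ : ℕ → S =>
        (Preorder.frestrictLe (π := fun _ => S) h σ, σ (h + 1)) :=
      (Preorder.measurable_frestrictLe (X := fun _ => S) h).prodMk (measurable_pi_apply _)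
    have hG : Measurable fun x : (i : Finset.Iic h) → S => ∫⁻ y, F (x, y) ∂(M.stepKernel h x) :=
      hF.lintegral_kernel_prod_right'
    -- the Markov property: integrate out the state at time `h + 1` given the states up to time `h`
    have key := lintegral_map (μ := Kernel.traj (X := fun _ => S) M.stepKernel 0 (fun _ => s)) hF
      hmeas
    rw [← Kernel.partialTraj_compProd_eq_map_traj (Nat.zero_le h), Measure.lintegral_compProd hF,
      ← Kernel.traj_map_frestrictLe_apply,
      lintegral_map hG (Preorder.measurable_frestrictLe (X := fun _ => S) h)] at key
    have hmem : ∀ σ : ℕ → S, (Preorder.frestrictLe (π := fun _ => S) h σ ∈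
        {x : (i : Finset.Iic h) → S | ∀ i, x i ∈ D}) ↔ ∀ i < h + 1, σ i ∈ D := fun σ =>
      ⟨fun H i hi => H ⟨i, Finset.mem_Iic.2 (Nat.lt_succ_iff.1 hi)⟩,
        fun H i => H i (Nat.lt_succ_iff.2 (Finset.mem_Iic.1 i.2))⟩
    refine Eq.trans ?_ (key.symm.trans ?_)
    · refine lintegral_congr fun σ => ?_
      by_cases H : ∀ i < h + 1, σ i ∈ D
      · simp only [F]
        rw [Set.indicator_of_mem ((hmem σ).2 H),
          Set.indicator_of_mem (s := {σ : ℕ → S | ∀ i < h + 1, σ i ∈ D}) H]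
        simp
      · simp only [F]
        rw [Set.indicator_of_notMem (fun h' => H ((hmem σ).1 h')),
          Set.indicator_of_notMem (s := {σ : ℕ → S | ∀ i < h + 1, σ i ∈ D}) H]
        simp
    · refine lintegral_congr fun σ => ?_
      have hker : M.stepKernel h (Preorder.frestrictLe (π := fun _ => S) h σ) =
          (M.step (σ h)).toMeasure := rfl
      rw [hker, lintegral_toMeasure]
      by_cases H : ∀ i < h + 1, σ i ∈ D
      · have H' : ∀ i < h, σ i ∈ D := fun i hi => H i (hi.trans (Nat.lt_succ_self h))
        simp only [F]
        rw [Set.indicator_of_mem ((hmem σ).2 H),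
          Set.indicator_of_mem (s := {σ : ℕ → S | ∀ i < h, σ i ∈ D}) H',
          stepWithin, Set.indicator_of_mem (H h (Nat.lt_succ_self h))]
        simp
      · simp only [F]
        rw [Set.indicator_of_notMem (fun h' => H ((hmem σ).1 h'))]
        by_cases H' : ∀ i < h, σ i ∈ D
        · have hh : σ h ∉ D := fun hh => H fun i hi =>
            (Nat.lt_succ_iff_lt_or_eq.1 hi).elim (H' i) fun e => e ▸ hh
          rw [Set.indicator_of_mem (s := {σ : ℕ → S | ∀ i < h, σ i ∈ D}) H', stepWithin,
            Set.indicator_of_notMem hh]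
          simp [pmfExp]
        · rw [Set.indicator_of_notMem (s := {σ : ℕ → S | ∀ i < h, σ i ∈ D}) H']
          simp [pmfExp]

theorem measurableSet_coord (A : Set S) (i : ℕ) :
    MeasurableSet[cylinderSigma S] {σ : ℕ → S | σ i ∈ A} := by
  let : MeasurableSpace S := ⊤
  have : DiscreteMeasurableSpace S := ⟨fun _ => trivial⟩
  exact measurable_pi_apply (X := fun _ : ℕ => S) i (MeasurableSet.of_discrete (s := A))

theorem measurableSet_forall_lt (D : Set S) (h : ℕ) :
    MeasurableSet[cylinderSigma S] {σ : ℕ → S | ∀ i < h, σ i ∈ D} := by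
  let := cylinderSigma S
  simp only [Set.ofPred_forall]
  exact MeasurableSet.iInter fun i => MeasurableSet.iInter fun _ => measurableSet_coord D i

theorem pathMeasure_forall_lt_inter (D B : Set S) (h : ℕ) (s : S) :
    M.pathMeasure s ({σ | ∀ i < h, σ i ∈ D} ∩ {σ | σ h ∈ B}) =
      (M.stepWithin D)^[h] (B.indicator 1) s := by
  let := cylinderSigma S
  rw [← lintegral_pathMeasure, ← lintegral_indicator_one
    ((measurableSet_forall_lt D h).inter (measurableSet_coord B h))]
  refine lintegral_congr fun σ => ?_
  by_cases h1 : σ ∈ {σ | ∀ i < h, σ i ∈ D} <;> by_cases h2 : σ h ∈ B <;>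
    simp [Set.indicator, h1, h2]

theorem pr_nextEvent (A : Set S) (s : S) :
    M.pr s (nextEvent A) = (M.stepWithin Set.univ (A.indicator 1) s).toReal := by
  have h := M.pathMeasure_forall_lt_inter Set.univ A 1 s
  rw [pr, nextEvent]
  congr 1
  simpa using h

/-- The paths that satisfy a bounded until formula are partitioned by the time of the first visit
to `B`; staying in `A \ B` before is what makes the summands disjoint. -/
theorem pr_untilEvent (A B : Set S) (k : ℕ) (s : S) :
    M.pr s (untilEvent A B k) =
      ∑ h ∈ Finset.range (k + 1), ((M.stepWithin (A \ B))^[h] (B.indicator 1) s).toReal := by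
  classical
  let := cylinderSigma S
  have hE : untilEvent A B k = ⋃ h ∈ Finset.range (k + 1),
      ({σ : ℕ → S | ∀ i < h, σ i ∈ A \ B} ∩ {σ | σ h ∈ B}) := by
    ext σ
    simp only [untilEvent, Set.mem_ofPred_eq, Set.mem_iUnion, Finset.mem_range, Set.mem_inter_iff,
      exists_prop]
    constructor
    · rintro ⟨h, hk, hB, hA⟩
      have hex : ∃ h, σ h ∈ B := ⟨h, hB⟩
      have hle : Nat.find hex ≤ h := Nat.find_min' hex hB
      exact ⟨Nat.find hex, by omega,
        fun i hi => ⟨hA i (hi.trans_le hle), Nat.find_min hex hi⟩, Nat.find_spec hex⟩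
    · rintro ⟨h, hk, hA, hB⟩
      exact ⟨h, by omega, hB, fun i hi => (hA i hi).1⟩
  rw [pr, hE, measure_biUnion_finset, ENNReal.toReal_sum]
  · exact Finset.sum_congr rfl fun h _ => by rw [pathMeasure_forall_lt_inter]
  · intro h _
    rw [pathMeasure_forall_lt_inter]
    refine ((M.iterate_stepWithin_le_one _ (fun y => ?_) h s).trans_lt ENNReal.one_lt_top).ne
    exact Set.indicator_le_self _ _ y
  · intro h₁ _ h₂ _ hne
    rw [Function.onFun, Set.disjoint_left]
    rintro σ ⟨hA₁, hB₁⟩ ⟨hA₂, hB₂⟩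
    rcases lt_or_gt_of_ne hne with hlt | hlt
    · exact (hA₂ h₁ hlt).2 hB₁
    · exact (hA₁ h₂ hlt).2 hB₂
  · exact fun h _ => (measurableSet_forall_lt _ h).inter (measurableSet_coord B h)

end LDTMC

/-! ### Concentration of independent finitely valued variables -/

section Concentration

variable {ι S : Type*} [Fintype ι] [DecidableEq ι] [Fintype S]

/-- Chernoff bound for a centred bounded variable: `exp z ≤ 1 + z + z²` for `|z| ≤ 1`. -/
theorem sum_mul_exp_le {w Z : S → ℝ} (hw : ∀ s, 0 ≤ w s) (hw1 : ∑ s, w s = 1)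
    (hZ : ∀ s, |Z s| ≤ 1) (hZ0 : ∑ s, w s * Z s = 0) {l : ℝ} (hl0 : 0 ≤ l) (hl : l ≤ 1) :
    ∑ s, w s * Real.exp (l * Z s) ≤ Real.exp (l ^ 2) := by
  have h1 : ∀ s, Real.exp (l * Z s) ≤ 1 + l * Z s + l ^ 2 := by
    intro s
    have ha : |l * Z s| ≤ 1 := by
      rw [abs_mul, abs_of_nonneg hl0]
      exact mul_le_one₀ hl (abs_nonneg _) (hZ s)
    have hb := (abs_le.1 (Real.abs_exp_sub_one_sub_id_le ha)).2
    have hc : Z s ^ 2 ≤ 1 := (sq_le_one_iff_abs_le_one _).2 (hZ s)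
    nlinarith [mul_le_mul_of_nonneg_left hc (sq_nonneg l)]
  calc ∑ s, w s * Real.exp (l * Z s)
      ≤ ∑ s, w s * (1 + l * Z s + l ^ 2) :=
        Finset.sum_le_sum fun s _ => mul_le_mul_of_nonneg_left (h1 s) (hw s)
    _ = (∑ s, w s) * (1 + l ^ 2) + l * ∑ s, w s * Z s := by
        rw [Finset.sum_mul, Finset.mul_sum, ← Finset.sum_add_distrib]
        exact Finset.sum_congr rfl fun s _ => by ring
    _ = l ^ 2 + 1 := by rw [hw1, hZ0]; ring
    _ ≤ Real.exp (l ^ 2) := Real.add_one_le_exp _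

/-- One-sided exponential tail bound under the product of the distributions `w i`. -/
theorem sum_prod_le_exp {w Z : ι → S → ℝ} (hw : ∀ i s, 0 ≤ w i s) (hw1 : ∀ i, ∑ s, w i s = 1)
    (hZ : ∀ i s, |Z i s| ≤ 1) (hZ0 : ∀ i, ∑ s, w i s * Z i s = 0) {ε : ℝ} (hε : 0 ≤ ε)
    (hε1 : ε ≤ 1) (E : Finset (ι → S)) (hE : ∀ x ∈ E, ε * Fintype.card ι ≤ ∑ i, Z i (x i)) :
    ∑ x ∈ E, ∏ i, w i (x i) ≤ Real.exp (-(ε ^ 2 / 4) * Fintype.card ι) := by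
  -- the choice `l = ε / 2` minimizes the exponent `l ^ 2 - l * ε`
  set l := ε / 2 with hl
  have hl0 : 0 ≤ l := by positivity
  have h1 : ∑ x ∈ E, ∏ i, w i (x i) ≤
      ∑ x ∈ E, (∏ i, w i (x i)) * Real.exp (l * (∑ i, Z i (x i)) - l * (ε * Fintype.card ι)) :=
    Finset.sum_le_sum fun x hx =>
      le_mul_of_one_le_right (Finset.prod_nonneg fun i _ => hw i _)
        (Real.one_le_exp (sub_nonneg.2 (mul_le_mul_of_nonneg_left (hE x hx) hl0)))
  have h2 : ∑ x ∈ E, (∏ i, w i (x i)) *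
      Real.exp (l * (∑ i, Z i (x i)) - l * (ε * Fintype.card ι)) ≤
      ∑ x : ι → S, (∏ i, w i (x i)) *
        Real.exp (l * (∑ i, Z i (x i)) - l * (ε * Fintype.card ι)) :=
    Finset.sum_le_sum_of_subset_of_nonneg (Finset.subset_univ _) fun x _ _ =>
      mul_nonneg (Finset.prod_nonneg fun i _ => hw i _) (Real.exp_pos _).le
  have h3 : ∑ x : ι → S, (∏ i, w i (x i)) *
        Real.exp (l * (∑ i, Z i (x i)) - l * (ε * Fintype.card ι)) =
      (∏ i, ∑ s, w i s * Real.exp (l * Z i s)) * Real.exp (-(l * (ε * Fintype.card ι))) := by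
    rw [Fintype.prod_sum, Finset.sum_mul]
    refine Finset.sum_congr rfl fun x _ => ?_
    rw [Finset.prod_mul_distrib, ← Real.exp_sum, ← Finset.mul_sum, sub_eq_add_neg, Real.exp_add]
    ring
  have h4 : ∏ i, ∑ s, w i s * Real.exp (l * Z i s) ≤ Real.exp (l ^ 2) ^ Fintype.card ι := by
    rw [← Finset.card_univ, ← Finset.prod_const]
    exact Finset.prod_le_prod
      (fun i _ => Finset.sum_nonneg fun s _ => mul_nonneg (hw i s) (Real.exp_pos _).le)
      fun i _ => sum_mul_exp_le (hw i) (hw1 i) (hZ i) (hZ0 i) hl0 (by linarith)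
  refine (h1.trans h2).trans ?_
  rw [h3]
  refine (mul_le_mul_of_nonneg_right h4 (Real.exp_pos _).le).trans_eq ?_
  rw [← Real.exp_nat_mul, ← Real.exp_add, hl]
  congr 1
  ring

theorem sum_prod_le_two_mul_exp {w Z : ι → S → ℝ} (hw : ∀ i s, 0 ≤ w i s)
    (hw1 : ∀ i, ∑ s, w i s = 1)
    (hZ : ∀ i s, |Z i s| ≤ 1) (hZ0 : ∀ i, ∑ s, w i s * Z i s = 0) {ε : ℝ} (hε : 0 ≤ ε)
    (hε1 : ε ≤ 1) (E : Finset (ι → S)) (hE : ∀ x ∈ E, ε * Fintype.card ι ≤ |∑ i, Z i (x i)|) :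
    ∑ x ∈ E, ∏ i, w i (x i) ≤ 2 * Real.exp (-(ε ^ 2 / 4) * Fintype.card ι) := by
  classical
  rw [← Finset.sum_filter_add_sum_filter_not E fun x => 0 ≤ ∑ i, Z i (x i), two_mul]
  refine add_le_add (sum_prod_le_exp hw hw1 hZ hZ0 hε hε1 _ fun x hx => ?_)
    (sum_prod_le_exp hw hw1 (Z := fun i s => -Z i s) (by simpa using hZ) (fun i => ?_) hε hε1 _
      fun x hx => ?_)
  · rw [Finset.mem_filter] at hx
    simpa [abs_of_nonneg hx.2] using hE x hx.1
  · simp only [mul_neg, Finset.sum_neg_distrib, hZ0, neg_zero]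
  · rw [Finset.mem_filter] at hx
    rw [Finset.sum_neg_distrib, ← abs_of_neg (not_le.1 hx.2)]
    exact hE x hx.1

/-- The marginals of a product of distributions. -/
theorem sum_prod_mul_apply [DecidableEq S] {w : ι → S → ℝ} (hw1 : ∀ i, ∑ s, w i s = 1) (i : ι)
    (g : S → ℝ) : ∑ x : ι → S, (∏ j, w j (x j)) * g (x i) = ∑ s, w i s * g s := by
  have h : ∀ x : ι → S, (∏ j, w j (x j)) * g (x i) =
      ∏ j, w j (x j) * (if j = i then g (x j) else 1) := by
    intro x
    rw [Finset.prod_mul_distrib]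
    congr 1
    rw [Finset.prod_ite_eq' Finset.univ i fun j => g (x j)]
    simp
  simp_rw [h]
  rw [← Fintype.prod_sum fun j s => w j s * (if j = i then g s else 1)]
  rw [Finset.prod_eq_single i]
  · simp
  · intro j _ hj
    simp [hj, hw1]
  · simp

end Concentration

/-! ### Large populations near an occupancy measure -/

theorem exists_pos_forall_abs_sub_lt {S : Type*} [Fintype S] {m : stdSimplex ℝ S}
    {V : Set (stdSimplex ℝ S)} (hV : V ∈ 𝓝 m) :
    ∃ ε > 0, ∀ x : stdSimplex ℝ S, (∀ c, |x.1 c - m.1 c| < ε) → x ∈ V := by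
  obtain ⟨ε, hε, h⟩ := Metric.mem_nhds_iff.1 hV
  exact ⟨ε, hε, fun x hx => h ((dist_pi_lt_iff hε).2 fun c => hx c)⟩

section Limit

variable {S Act : Type*} [Fintype S] [DecidableEq S] [DecidableEq Act]
variable {Δ : ObjectSpec S Act}

theorem sum_occupancy_mul {N : ℕ+} (C : Fin N → S) (g : S → ℝ) :
    ∑ c, (occupancy C).1 c * g c = (1 / ((N : ℕ) : ℝ)) * ∑ n, g (C n) := by
  simp only [occupancy, mul_assoc, ← Finset.mul_sum, Finset.sum_mul]
  rw [Finset.sum_comm]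
  simp

namespace SystemSpec

/-- After one step from `C`, every fraction is exponentially unlikely to differ by `ε` from its
expectation. -/
theorem sum_globalMatrix_le_exp {N : ℕ+} (sys : SystemSpec Δ N) (C : Fin N → S) {ε : ℝ}
    (hε : 0 ≤ ε) (hε1 : ε ≤ 1) (c : S) (E : Finset (Fin N → S))
    (hE : ∀ C' ∈ E, ε ≤ |(occupancy C').1 c -
      Matrix.vecMul (occupancy C).1 (sys.otm (occupancy C)) c|) :
    ∑ C' ∈ E, sys.globalMatrix C C' ≤ 2 * Real.exp (-(ε ^ 2 / 4) * (N : ℕ)) := by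
  have hW := sys.otm_mem C
  set W := sys.otm (occupancy C) with hWdef
  have hN : (0 : ℝ) < ((N : ℕ) : ℝ) := by exact_mod_cast N.pos
  have hmean : Matrix.vecMul (occupancy C).1 W c = (1 / ((N : ℕ) : ℝ)) * ∑ n, W (C n) c :=
    sum_occupancy_mul C fun d => W d c
  have h0 : ∀ d, 0 ≤ W d c := fun d => Matrix.nonneg_of_mem_rowStochastic hW
  have h1 : ∀ d, W d c ≤ 1 := fun d => by
    rw [← Matrix.sum_row_of_mem_rowStochastic hW d]
    exact Finset.single_le_sum (f := fun j => W d j)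
      (fun i _ => Matrix.nonneg_of_mem_rowStochastic hW)
      (Finset.mem_univ c)
  have key := sum_prod_le_two_mul_exp (w := fun n d => W (C n) d)
    (Z := fun n d => (if d = c then 1 else 0) - W (C n) c)
    (fun n d => Matrix.nonneg_of_mem_rowStochastic hW)
    (fun n => Matrix.sum_row_of_mem_rowStochastic hW _)
    (fun n d => by
      rw [abs_le]
      constructor <;> split_ifs <;> linarith [h0 (C n), h1 (C n)])
    (fun n => by
      simp only [mul_sub, Finset.sum_sub_distrib, ← Finset.sum_mul,
        Matrix.sum_row_of_mem_rowStochastic hW]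
      simp)
    hε hε1 E (fun C' hC' => by
      have h := hE C' hC'
      have hdiff : ∑ n, ((if C' n = c then (1 : ℝ) else 0) - W (C n) c) =
          (N : ℕ) * ((occupancy C').1 c - Matrix.vecMul (occupancy C).1 W c) := by
        rw [hmean]
        simp only [occupancy, Finset.sum_sub_distrib]
        field_simp
      rw [hdiff, abs_mul, abs_of_pos hN, Fintype.card_fin, mul_comm]
      exact mul_le_mul_of_nonneg_left h hN.le)
  rw [Fintype.card_fin] at key
  exact key

theorem sum_globalMatrix_mul_zero {N : ℕ+} (sys : SystemSpec Δ N) (C : Fin N → S) (g : S → ℝ) :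
    ∑ C', sys.globalMatrix C C' * g (C' 0) = ∑ c, sys.otm (occupancy C) (C 0) c * g c :=
  sum_prod_mul_apply (w := fun n d => sys.otm (occupancy C) (C n) d)
    (fun _ => Matrix.sum_row_of_mem_rowStochastic (sys.otm_mem C) _) 0 g

end SystemSpec

/-- A population size `N ≥ N₀` together with a global state of `N` objects. -/
abbrev PopState (S : Type*) (N₀ : ℕ+) : Type _ :=
  Σ N : Set.Ici N₀, (Fin (N : ℕ+) → S)

/-- Convergence along this filter is convergence as the population size tends to infinity and the
occupancy measure tends to `m`, uniformly in the global state. -/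
noncomputable def nearFilter (N₀ : ℕ+) (m : stdSimplex ℝ S) : Filter (PopState S N₀) :=
  comap (fun p => (p.1, occupancy p.2)) (atTop ×ˢ 𝓝 m)

variable {N₀ : ℕ+}

theorem tendsto_nearFilter {α : Type*} {l : Filter α} {m : stdSimplex ℝ S}
    {u : α → PopState S N₀} (h₁ : Tendsto (fun x => (u x).1) l atTop)
    (h₂ : Tendsto (fun x => occupancy (u x).2) l (𝓝 m)) : Tendsto u l (nearFilter N₀ m) :=
  tendsto_comap_iff.2 (h₁.prodMk h₂)

theorem tendsto_fst_nearFilter (m : stdSimplex ℝ S) :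
    Tendsto (fun p : PopState S N₀ => p.1) (nearFilter N₀ m) atTop :=
  tendsto_fst.comp tendsto_comap

theorem tendsto_occupancy_nearFilter (m : stdSimplex ℝ S) :
    Tendsto (fun p : PopState S N₀ => occupancy p.2) (nearFilter N₀ m) (𝓝 m) :=
  tendsto_snd.comp tendsto_comap

theorem eventually_nearFilter {m : stdSimplex ℝ S} {q : PopState S N₀ → Prop}
    (h : ∀ᶠ p in nearFilter N₀ m, q p) :
    ∃ U ∈ 𝓝 m, ∀ᶠ N in atTop, ∀ C : Fin (N : Set.Ici N₀) → S, occupancy C ∈ U → q ⟨N, C⟩ := by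
  rw [nearFilter, eventually_comap, eventually_prod_iff] at h
  obtain ⟨a, ha, b, hb, hab⟩ := h
  exact ⟨{x | b x}, hb, ha.mono fun N hN C hC => hab hN hC ⟨N, C⟩ rfl⟩

theorem summable_exp_neg_mul {a : ℝ} (ha : 0 < a) :
    Summable fun N : Set.Ici N₀ => Real.exp (-a * (((N : ℕ+) : ℕ) : ℝ)) := by
  have h : Summable fun n : ℕ => Real.exp (-a * n) := by
    simpa [mul_comm] using Real.summable_exp_nat_mul_iff.2 (neg_lt_zero.2 ha)
  exact h.comp_injective (i := fun N : Set.Ici N₀ => ((N : ℕ+) : ℕ))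
    (PNat.coe_injective.comp Subtype.val_injective)

variable (sys : (N : Set.Ici N₀) → SystemSpec Δ N)
variable {K : stdSimplex ℝ S → Matrix S S ℝ} (hK : ∀ m, K m ∈ Matrix.rowStochastic ℝ S)
variable (hKcont : ∀ c c', Continuous fun m => K m c c')
variable (hKlim : ∀ c c',
  TendstoUniformly (fun N m => (sys N).otm m c c') (fun m => K m c c') atTop)

include hKcont hKlim

theorem tendsto_otm (m : stdSimplex ℝ S) (c c' : S) :
    Tendsto (fun p => (sys p.1).otm (occupancy p.2) c c') (nearFilter N₀ m) (𝓝 (K m c c')) := by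
  have hd : Tendsto (fun p : PopState S N₀ =>
      (sys p.1).otm (occupancy p.2) c c' - K (occupancy p.2) c c') (nearFilter N₀ m) (𝓝 0) := by
    rw [Metric.tendsto_nhds]
    intro ε hε
    filter_upwards [(tendsto_fst_nearFilter m).eventually
      (Metric.tendstoUniformly_iff.1 (hKlim c c') ε hε)] with p hp
    rw [dist_zero_right, ← dist_eq_norm, dist_comm]
    exact hp _
  simpa using hd.add (((hKcont c c').tendsto m).comp (tendsto_occupancy_nearFilter m))

include hK

/-- The one-step probability of leaving a neighbourhood of `m · K(m)`, from global states whose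
occupancy measure is near `m`, is summable over the population sizes. -/
theorem exists_summable_escape (m : stdSimplex ℝ S) {V : Set (stdSimplex ℝ S)}
    (hV : V ∈ 𝓝 (drift K hK m)) :
    ∃ δ : Set.Ici N₀ → ℝ, Summable δ ∧ ∀ᶠ p in nearFilter N₀ m,
      ∑ C', (sys p.1).globalMatrix p.2 C' * Vᶜ.indicator 1 (occupancy C') ≤ δ p.1 := by
  classical
  obtain ⟨ε₀, hε₀, hball⟩ := exists_pos_forall_abs_sub_lt hV
  -- half of `ε₀` is for the distance of the expectation from `m · K(m)`, the rest for the deviation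
  -- from the expectation
  set ε := min (ε₀ / 2) 1 with hεdef
  have hε : 0 < ε := lt_min (by positivity) one_pos
  refine ⟨fun N => ∑ _c : S, 2 * Real.exp (-(ε ^ 2 / 4) * (((N : ℕ+) : ℕ) : ℝ)), ?_, ?_⟩
  · exact summable_sum fun c _ => (summable_exp_neg_mul (by positivity)).mul_left 2
  have hmean : ∀ c, ∀ᶠ p : PopState S N₀ in nearFilter N₀ m,
      |Matrix.vecMul (occupancy p.2).1 ((sys p.1).otm (occupancy p.2)) c -
        (drift K hK m).1 c| < ε₀ / 2 := by
    intro c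
    have h : Tendsto (fun p : PopState S N₀ =>
        Matrix.vecMul (occupancy p.2).1 ((sys p.1).otm (occupancy p.2)) c) (nearFilter N₀ m)
        (𝓝 ((drift K hK m).1 c)) :=
      tendsto_finsetSum _ fun d _ =>
        ((((continuous_apply d).comp continuous_subtype_val).tendsto m).comp
          (tendsto_occupancy_nearFilter m)).mul (tendsto_otm sys hKcont hKlim m d c)
    exact (Metric.tendsto_nhds.1 h) (ε₀ / 2) (by positivity)
  filter_upwards [eventually_all.2 hmean] with p hp
  have hnn : ∀ C', 0 ≤ (sys p.1).globalMatrix p.2 C' := fun C' =>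
    Matrix.nonneg_of_mem_rowStochastic (sys p.1).globalMatrix_mem
  let E : S → Finset (Fin (p.1 : ℕ+) → S) := fun c => Finset.univ.filter fun C' =>
    ε ≤ |(occupancy C').1 c - Matrix.vecMul (occupancy p.2).1 ((sys p.1).otm (occupancy p.2)) c|
  have hpt : ∀ C', (sys p.1).globalMatrix p.2 C' * Vᶜ.indicator 1 (occupancy C') ≤
      ∑ c, if C' ∈ E c then (sys p.1).globalMatrix p.2 C' else 0 := by
    intro C'
    by_cases hC : occupancy C' ∈ V
    · rw [Set.indicator_of_notMem (by simpa using hC), mul_zero]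
      exact Finset.sum_nonneg fun c _ => by split_ifs <;> simp [hnn]
    · rw [Set.indicator_of_mem (by simpa using hC), Pi.one_apply, mul_one]
      obtain ⟨c, hc⟩ : ∃ c, ε₀ ≤ |(occupancy C').1 c - (drift K hK m).1 c| := by
        by_contra! hcon
        exact hC (hball _ hcon)
      have hmem : C' ∈ E c := by
        refine Finset.mem_filter.2 ⟨Finset.mem_univ _, (min_le_left _ _).trans ?_⟩
        have := abs_sub_le ((occupancy C').1 c)
          (Matrix.vecMul (occupancy p.2).1 ((sys p.1).otm (occupancy p.2)) c)
          ((drift K hK m).1 c)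
        linarith [hp c]
      refine le_trans ?_ (Finset.single_le_sum (fun c _ => ?_) (Finset.mem_univ c))
      · rw [if_pos hmem]
      · split_ifs <;> simp [hnn]
  refine (Finset.sum_le_sum fun C' _ => hpt C').trans ?_
  rw [Finset.sum_comm]
  refine Finset.sum_le_sum fun c _ => ?_
  rw [← Finset.sum_filter, Finset.filter_mem_eq_inter, Finset.univ_inter]
  exact (sys p.1).sum_globalMatrix_le_exp p.2 hε.le (min_le_right _ _) c _ fun C' hC' =>
    (Finset.mem_filter.1 hC').2

/-- If near `m · K(m)` the values `f` depend in the limit only on the state of the first object,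
then so do near `m` the one-step expectations of `f`, which tend to those of the limit chain. -/
theorem tendsto_step (m : stdSimplex ℝ S) {f : PopState S N₀ → ℝ} {g : S → ℝ}
    (hf : ∀ p, f p ∈ Set.Icc 0 1) (hg : ∀ c, g c ∈ Set.Icc 0 1)
    (h : Tendsto (fun p => f p - g (p.2 0)) (nearFilter N₀ (drift K hK m)) (𝓝 0)) :
    Tendsto (fun p : PopState S N₀ => ∑ C', (sys p.1).globalMatrix p.2 C' * f ⟨p.1, C'⟩ -
      ∑ c, K m (p.2 0) c * g c) (nearFilter N₀ m) (𝓝 0) := by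
  -- replace `f` by `g`: the error is small near `m · K(m)`, and at most one elsewhere
  have hA : Tendsto (fun p : PopState S N₀ => ∑ C', (sys p.1).globalMatrix p.2 C' *
      (f ⟨p.1, C'⟩ - g (C' 0))) (nearFilter N₀ m) (𝓝 0) := by
    rw [Metric.tendsto_nhds]
    intro ε hε
    obtain ⟨V, hV, hVN⟩ := eventually_nearFilter (Metric.tendsto_nhds.1 h (ε / 2) (by positivity))
    obtain ⟨δ, hδ, hδle⟩ := exists_summable_escape sys hK hKcont hKlim m hV
    have hδ0 : Tendsto (fun p : PopState S N₀ => δ p.1) (nearFilter N₀ m) (𝓝 0) :=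
      (hδ.tendsto_cofinite_zero.mono_left atTop_le_cofinite).comp (tendsto_fst_nearFilter m)
    filter_upwards [hδle, hδ0.eventually (gt_mem_nhds (half_pos hε)),
      (tendsto_fst_nearFilter m).eventually hVN] with p h1 h2 h3
    have hnn : ∀ C', 0 ≤ (sys p.1).globalMatrix p.2 C' := fun C' =>
      Matrix.nonneg_of_mem_rowStochastic (sys p.1).globalMatrix_mem
    have hsum : ∑ C', (sys p.1).globalMatrix p.2 C' = 1 :=
      Matrix.sum_row_of_mem_rowStochastic (sys p.1).globalMatrix_mem _
    rw [dist_zero_right, Real.norm_eq_abs]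
    calc |∑ C', (sys p.1).globalMatrix p.2 C' * (f ⟨p.1, C'⟩ - g (C' 0))|
        ≤ ∑ C', (sys p.1).globalMatrix p.2 C' * (ε / 2 + Vᶜ.indicator 1 (occupancy C')) := by
          refine (Finset.abs_sum_le_sum_abs _ _).trans (Finset.sum_le_sum fun C' _ => ?_)
          rw [abs_mul, abs_of_nonneg (hnn C')]
          refine mul_le_mul_of_nonneg_left ?_ (hnn C')
          by_cases hC : occupancy C' ∈ V
          · rw [Set.indicator_of_notMem (by simpa using hC), add_zero]
            have := h3 C' hC
            rw [dist_zero_right, Real.norm_eq_abs] at this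
            exact this.le
          · rw [Set.indicator_of_mem (by simpa using hC), Pi.one_apply, abs_le]
            have h4 := hf ⟨p.1, C'⟩
            have h5 := hg (C' 0)
            constructor <;> linarith [h4.1, h4.2, h5.1, h5.2]
      _ = ε / 2 + ∑ C', (sys p.1).globalMatrix p.2 C' * Vᶜ.indicator 1 (occupancy C') := by
          simp only [mul_add, Finset.sum_add_distrib, ← Finset.sum_mul, hsum, one_mul]
      _ < ε := by linarith
  -- what is left depends on the first object only, whose transition probabilities converge
  have hB : Tendsto (fun p : PopState S N₀ =>
      ∑ c, ((sys p.1).otm (occupancy p.2) (p.2 0) c - K m (p.2 0) c) * g c)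
      (nearFilter N₀ m) (𝓝 0) := by
    have hb : Tendsto (fun p : PopState S N₀ =>
        ∑ d, |∑ c, ((sys p.1).otm (occupancy p.2) d c - K m d c) * g c|)
        (nearFilter N₀ m) (𝓝 0) := by
      have : Tendsto (fun p : PopState S N₀ =>
          ∑ d, |∑ c, ((sys p.1).otm (occupancy p.2) d c - K m d c) * g c|)
          (nearFilter N₀ m) (𝓝 (∑ d, |∑ c, (K m d c - K m d c) * g c|)) :=
        tendsto_finsetSum _ fun d _ => (tendsto_finsetSum _ fun c _ =>
          ((tendsto_otm sys hKcont hKlim m d c).sub_const _).mul_const _).abs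
      simpa using this
    refine squeeze_zero_norm (fun p => ?_) hb
    exact Finset.single_le_sum
      (f := fun d => |∑ c, ((sys p.1).otm (occupancy p.2) d c - K m d c) * g c|)
      (fun _ _ => abs_nonneg _) (Finset.mem_univ (p.2 0))
  refine (by simpa using hA.add hB : Tendsto _ _ _).congr fun p => ?_
  simp only [mul_sub, sub_mul, Finset.sum_sub_distrib]
  rw [(sys p.1).sum_globalMatrix_mul_zero p.2 g]
  ring

end Limit

/-! ### Almost sure convergence of the occupancy measures -/

namespace LDTMC.IsRealizedBy

variable {T AP : Type*} [Fintype T] {M : LDTMC T AP} {Ω : Type*} [MeasurableSpace Ω]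
  {P : Measure Ω} {X : ℕ → Ω → T}

/-- The joint law of two successive states. -/
theorem measure_inter (hX : M.IsRealizedBy P X) (t : ℕ) (a b : T) :
    P {ω | X t ω = a ∧ X (t + 1) ω = b} = P {ω | X t ω = a} * M.step a b := by
  classical
  -- a sequence of states with a prescribed beginning `x`
  let e : (Fin (t + 1) → T) → ℕ → T := fun x i => if h : i < t + 1 then x ⟨i, h⟩ else b
  let E : (Fin (t + 1) → T) → Set Ω := fun x => {ω | ∀ i ≤ t, X i ω = e x i}
  have hEm : ∀ x, MeasurableSet (E x) := fun x => by
    have : E x = ⋂ i, ⋂ _ : i ≤ t, {ω | X i ω = e x i} := by ext; simp [E]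
    rw [this]
    exact MeasurableSet.iInter fun i => MeasurableSet.iInter fun _ => hX.measurable _ _
  have hEd : ∀ F : Set Ω, MeasurableSet F → P F = ∑ x, P (F ∩ E x) := fun F hF => by
    rw [← measure_biUnion_finset]
    · congr 1
      ext ω
      simp only [Finset.mem_univ, Set.iUnion_true, Set.mem_iUnion, Set.mem_inter_iff,
        exists_and_left, iff_self_and]
      intro _
      refine ⟨fun i => X i ω, fun i hi => ?_⟩
      simp only [e]
      rw [dif_pos (Nat.lt_succ_iff.2 hi)]
    · intro x _ y _ hxy
      rw [Function.onFun, Set.disjoint_left]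
      rintro ω ⟨_, hx⟩ ⟨_, hy⟩
      refine hxy (funext fun i => ?_)
      have h := (hx i (Nat.lt_succ_iff.1 i.2)).symm.trans (hy i (Nat.lt_succ_iff.1 i.2))
      simpa [e, Nat.lt_succ_iff.1 i.2] using h
    · exact fun x _ => hF.inter (hEm x)
  have hm2 : MeasurableSet {ω | X t ω = a ∧ X (t + 1) ω = b} :=
    (hX.measurable t a).inter (hX.measurable (t + 1) b)
  rw [hEd _ hm2, hEd _ (hX.measurable t a), Finset.sum_mul]
  refine Finset.sum_congr rfl fun x _ => ?_
  have ht1 : e x (t + 1) = b := by simp [e]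
  by_cases hxa : e x t = a
  · have h1 : {ω | X t ω = a ∧ X (t + 1) ω = b} ∩ E x = {ω | ∀ i ≤ t + 1, X i ω = e x i} := by
      ext ω
      constructor
      · rintro ⟨⟨_, h2⟩, h3⟩ i hi
        rcases Nat.le_succ_iff.1 hi with h | rfl
        · exact h3 i h
        · exact h2.trans ht1.symm
      · intro h
        exact ⟨⟨(h t (Nat.le_succ t)).trans hxa, (h _ le_rfl).trans ht1⟩,
          fun i hi => h i (hi.trans (Nat.le_succ t))⟩
    have h2 : {ω | X t ω = a} ∩ E x = {ω | ∀ i ≤ t, X i ω = e x i} :=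
      Set.inter_eq_right.2 fun ω hω => (hω t le_rfl).trans hxa
    rw [h1, h2, hX.markov, hxa, ht1]
  · have h0 : {ω | X t ω = a} ∩ E x = ∅ := by
      rw [Set.eq_empty_iff_forall_notMem]
      rintro ω ⟨h1, h2⟩
      exact hxa ((h2 t le_rfl).symm.trans h1)
    have h0' : {ω | X t ω = a ∧ X (t + 1) ω = b} ∩ E x = ∅ :=
      Set.subset_eq_empty (Set.inter_subset_inter_left _ fun ω hω => hω.1) h0
    rw [h0, h0']
    simp

/-- Almost surely a realization of a finite chain takes only steps of positive probability. -/
theorem ae_step_pos (hX : M.IsRealizedBy P X) :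
    ∀ᵐ ω ∂P, ∀ t, 0 < M.step (X t ω) (X (t + 1) ω) := by
  rw [ae_all_iff]
  intro t
  have h : ∀ᵐ ω ∂P, ∀ a b, M.step a b = 0 → ¬ (X t ω = a ∧ X (t + 1) ω = b) := by
    refine ae_all_iff.2 fun a => ae_all_iff.2 fun b => ?_
    by_cases hab : M.step a b = 0
    · have h0 := hX.measure_inter t a b
      rw [hab, mul_zero] at h0
      filter_upwards [measure_eq_zero_iff_ae_notMem.1 h0] with ω hω _ using hω
    · exact Eventually.of_forall fun ω h => absurd h hab
  filter_upwards [h] with ω hω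
  exact pos_iff_ne_zero.2 fun h0 => hω _ _ h0 ⟨rfl, rfl⟩

/-- The probability to be in `E` at time `t + 1` is at most the probability to be outside `U` at
time `t` plus a bound on the one-step probability of entering `E` from `U`. -/
theorem measure_succ_mem_le [IsProbabilityMeasure P] (hX : M.IsRealizedBy P X) (t : ℕ)
    (U E : Set T) {δ : ℝ≥0∞} (hδ : ∀ a ∈ U, ∑ b, M.step a b * E.indicator 1 b ≤ δ) :
    P {ω | X (t + 1) ω ∈ E} ≤ P {ω | X t ω ∉ U} + δ := by
  classical
  have hsum : ∑ a, P {ω | X t ω = a} = 1 := by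
    rw [← measure_univ (μ := P), ← measure_biUnion_finset]
    · congr 1
      ext ω
      simp
    · intro x _ y _ hxy
      rw [Function.onFun, Set.disjoint_left]
      exact fun ω h1 h2 => hxy (h1.symm.trans h2)
    · exact fun a _ => hX.measurable t a
  have hsub : {ω | X (t + 1) ω ∈ E} ⊆ {ω | X t ω ∉ U} ∪
      ⋃ a ∈ Finset.univ.filter (· ∈ U), ⋃ b ∈ Finset.univ.filter (· ∈ E),
        {ω | X t ω = a ∧ X (t + 1) ω = b} := by
    intro ω hω
    by_cases h : X t ω ∈ U
    · refine Or.inr ?_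
      simp only [Set.mem_iUnion]
      exact ⟨X t ω, by simpa using h, X (t + 1) ω, by simpa using hω, rfl, rfl⟩
    · exact Or.inl h
  refine (measure_mono hsub).trans ((measure_union_le _ _).trans (add_le_add le_rfl ?_))
  calc P (⋃ a ∈ Finset.univ.filter (· ∈ U), ⋃ b ∈ Finset.univ.filter (· ∈ E),
        {ω | X t ω = a ∧ X (t + 1) ω = b})
      ≤ ∑ a ∈ Finset.univ.filter (· ∈ U), ∑ b ∈ Finset.univ.filter (· ∈ E),
          P {ω | X t ω = a ∧ X (t + 1) ω = b} :=
        (measure_biUnion_finset_le _ _).trans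
          (Finset.sum_le_sum fun a _ => measure_biUnion_finset_le _ _)
    _ ≤ ∑ a ∈ Finset.univ.filter (· ∈ U), P {ω | X t ω = a} * δ := by
        refine Finset.sum_le_sum fun a ha => ?_
        simp_rw [hX.measure_inter t a]
        rw [← Finset.mul_sum]
        gcongr
        refine (le_of_eq ?_).trans (hδ a (Finset.mem_filter.1 ha).2)
        rw [Finset.sum_filter]
        exact Finset.sum_congr rfl fun b _ => by by_cases hb : b ∈ E <;> simp [hb]
    _ ≤ ∑ a, P {ω | X t ω = a} * δ :=
        Finset.sum_le_sum_of_subset (Finset.subset_univ _)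
    _ = δ := by rw [← Finset.sum_mul, hsum, one_mul]

end LDTMC.IsRealizedBy

section Convergence

variable {S Act AP₁ APg : Type*} [Fintype S] [DecidableEq S] [DecidableEq Act]
  {Δ : ObjectSpec S Act} (loc : S → Set AP₁) (glob : APg → BExp S) {N₀ : ℕ+}
  (sys : (N : Set.Ici N₀) → SystemSpec Δ N)
  {K : stdSimplex ℝ S → Matrix S S ℝ} (hK : ∀ m, K m ∈ Matrix.rowStochastic ℝ S)
  (hKcont : ∀ c c', Continuous fun m => K m c c')
  (hKlim : ∀ c c', TendstoUniformly (fun N m => (sys N).otm m c c') (fun m => K m c c') atTop)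
  {μ₀ : stdSimplex ℝ S} (hμ₀ : Tendsto (fun N => occupancy (sys N).start) atTop (𝓝 μ₀))
  {Ω : Type*} [MeasurableSpace Ω] {P : Measure Ω} [IsProbabilityMeasure P]
  {X : (N : Set.Ici N₀) → ℕ → Ω → (Fin (N : ℕ+) → S)}
  (hX : ∀ N, ((sys N).chain loc glob).IsRealizedBy P (X N))

theorem eventually_cofinite_of_eventually_atTop {q : Set.Ici N₀ → Prop}
    (h : ∀ᶠ N in atTop, q N) : ∀ᶠ N in cofinite, q N := by
  obtain ⟨N₁, hN₁⟩ := eventually_atTop.1 h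
  have hfin : ((fun N : Set.Ici N₀ => (N : ℕ+)) ⁻¹' Set.Iio (N₁ : ℕ+)).Finite :=
    (Set.finite_Iio _).preimage Subtype.val_injective.injOn
  filter_upwards [hfin.compl_mem_cofinite] with N hN
  exact hN₁ N (not_lt.1 hN)

include hKcont hKlim hμ₀ hX

/-- The probability that the occupancy measure at time `t` is outside a given neighbourhood of
`μ(t)` is summable over the population sizes. -/
theorem summable_measureReal_occupancy_notMem (t : ℕ) {V : Set (stdSimplex ℝ S)}
    (hV : V ∈ 𝓝 (meanField K hK μ₀ t)) :
    Summable fun N => P.real {ω | occupancy (X N t ω) ∉ V} := by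
  induction t generalizing V with
  | zero =>
    refine summable_zero.of_norm_bounded_eventually
      (eventually_cofinite_of_eventually_atTop ?_)
    filter_upwards [hμ₀.eventually_mem hV] with N hN
    have h0 : P {ω | occupancy (X N 0 ω) ∉ V} = 0 := by
      rw [measure_eq_zero_iff_ae_notMem]
      filter_upwards [(hX N).start] with ω hω hω'
      exact hω' (by rw [hω]; exact hN)
    simp [Measure.real, h0]
  | succ t ih =>
    obtain ⟨δ, hδ, hle⟩ := exists_summable_escape sys hK hKcont hKlim (meanField K hK μ₀ t) hV
    obtain ⟨U, hU, hUN⟩ := eventually_nearFilter hle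
    refine ((ih hU).add hδ.norm).of_norm_bounded_eventually
      (eventually_cofinite_of_eventually_atTop ?_)
    filter_upwards [hUN] with N hN
    have h := (hX N).measure_succ_mem_le t {C | occupancy C ∈ U} {C | occupancy C ∉ V}
      (δ := ENNReal.ofReal ‖δ N‖) fun C hC => by
        refine le_trans (le_of_eq ?_)
          (ENNReal.ofReal_le_ofReal ((hN C hC).trans (Real.le_norm_self _)))
        have hnn : ∀ C' ∈ Finset.univ, 0 ≤ (sys N).globalMatrix C C' *
            Vᶜ.indicator (1 : stdSimplex ℝ S → ℝ) (occupancy C') := fun C' _ =>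
          mul_nonneg (Matrix.nonneg_of_mem_rowStochastic (sys N).globalMatrix_mem)
            (Set.indicator_nonneg (fun _ _ => zero_le_one) _)
        rw [ENNReal.ofReal_sum_of_nonneg hnn]
        refine Finset.sum_congr rfl fun C' _ => ?_
        by_cases hC' : occupancy C' ∈ V <;>
          simp [hC', SystemSpec.chain, rowPMF]
    rw [Real.norm_of_nonneg measureReal_nonneg]
    refine (ENNReal.toReal_mono (by simp) h).trans_eq ?_
    rw [ENNReal.toReal_add (by simp) (by simp), ENNReal.toReal_ofReal (norm_nonneg _)]
    rfl

/-- By the Borel–Cantelli lemma the occupancy measures converge almost surely to the mean field,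
whatever the joint distribution of the chains. -/
theorem ae_tendsto_occupancy (t : ℕ) :
    ∀ᵐ ω ∂P, Tendsto (fun N => occupancy (X N t ω)) atTop (𝓝 (meanField K hK μ₀ t)) := by
  obtain ⟨V, hV⟩ := (𝓝 (meanField K hK μ₀ t)).exists_antitone_basis
  have h : ∀ n, ∀ᵐ ω ∂P, ∀ᶠ N in atTop, occupancy (X N t ω) ∈ V n := by
    intro n
    have hs := summable_measureReal_occupancy_notMem loc glob sys hK hKcont hKlim hμ₀ hX t
      (hV.mem n)
    have hne : ∑' N, P {ω | occupancy (X N t ω) ∉ V n} ≠ ∞ := by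
      have := hs.tsum_ofReal_ne_top
      simpa [Measure.real] using this
    filter_upwards [ae_finite_setOfPred_mem hne] with ω hω
    have := atTop_le_cofinite hω.compl_mem_cofinite
    filter_upwards [this] with N hN
    simpa using hN
  filter_upwards [ae_all_iff.2 h] with ω hω
  exact hV.tendsto_right_iff.2 fun n _ => hω n

end Convergence

/-! ### Convergence of path probabilities and of the satisfaction relation -/

theorem pmfExp_rowPMF_toReal {S : Type*} [Fintype S] [DecidableEq S] (K : Matrix S S ℝ)
    (hK : K ∈ Matrix.rowStochastic ℝ S) (c : S) {f : S → ℝ≥0∞} (hf : ∀ c', f c' ≤ 1) :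
    (pmfExp (rowPMF K hK c) f).toReal = ∑ c', K c c' * (f c').toReal := by
  rw [pmfExp, tsum_fintype, ENNReal.toReal_sum]
  · refine Finset.sum_congr rfl fun c' _ => ?_
    rw [ENNReal.toReal_mul, rowPMF, PMF.ofFintype_apply,
      ENNReal.toReal_ofReal (Matrix.nonneg_of_mem_rowStochastic hK)]
  · exact fun c' _ => ENNReal.mul_ne_top (PMF.apply_ne_top _ _)
      ((hf c').trans_lt ENNReal.one_lt_top).ne

theorem indicator_one_le_one {T : Type*} (A : Set T) (x : T) :
    A.indicator (1 : T → ℝ≥0∞) x ≤ 1 :=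
  Set.indicator_le_self _ _ x

theorem toReal_mem_Icc {x : ℝ≥0∞} (hx : x ≤ 1) : x.toReal ∈ Set.Icc (0 : ℝ) 1 :=
  ⟨ENNReal.toReal_nonneg, by simpa using ENNReal.toReal_mono ENNReal.one_ne_top hx⟩

/-- A comparison with `p` is stable under small perturbations of values different from `p`. -/
theorem Cmp.eventually_holds_iff {α S : Type*} [Finite S] {l : Filter α} {u : α → ℝ} {v : S → ℝ}
    {φ : α → S} (h : Tendsto (fun x => u x - v (φ x)) l (𝓝 0)) {p : ℝ} (hv : ∀ c, v c ≠ p)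
    (r : Cmp) : ∀ᶠ x in l, (r.Holds (u x) p ↔ r.Holds (v (φ x)) p) := by
  have hc : ∀ c, ∀ᶠ x in l, |u x - v (φ x)| < |v c - p| := fun c => by
    simpa using (Metric.tendsto_nhds.1 h) _ (abs_pos.2 (sub_ne_zero.2 (hv c)))
  filter_upwards [eventually_all.2 hc] with x hx
  have hx := hx (φ x)
  rcases lt_or_gt_of_ne (hv (φ x)) with hlt | hlt
  · rw [abs_of_neg (sub_neg.2 hlt), abs_lt] at hx
    cases r <;> simp only [Cmp.Holds] <;> constructor <;> intro _ <;> linarith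
  · rw [abs_of_pos (sub_pos.2 hlt), abs_lt] at hx
    cases r <;> simp only [Cmp.Holds] <;> constructor <;> intro _ <;> linarith

section Labels

variable {S AP₁ APg : Type*} [Fintype S]

theorem BExp.continuous_value (b : BExp S) : Continuous b.value := by
  refine b.continuousOn.comp_continuous 
    (continuous_pi fun i => (continuous_apply _).comp continuous_subtype_val) fun m => ?_
  exact ⟨fun i => m.2.1 _, fun i => (mem_Icc_of_mem_stdSimplex m.2 _).2⟩

theorem BExp.eventually_holds_iff (b : BExp S) {m : stdSimplex ℝ S} (h : b.value m ≠ b.r) :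
    ∀ᶠ x in 𝓝 m, (b.Holds x ↔ b.Holds m) := by
  have hv := b.continuous_value.tendsto m
  rcases lt_or_gt_of_ne h with hlt | hlt
  · filter_upwards [hv.eventually (gt_mem_nhds hlt)] with x hx
    simp only [BExp.Holds]
    split_ifs <;> simp [hx, hlt, hx.not_gt, hlt.not_gt]
  · filter_upwards [hv.eventually (lt_mem_nhds hlt)] with x hx
    simp only [BExp.Holds]
    split_ifs <;> simp [hx, hlt, hx.not_gt, hlt.not_gt]

theorem inl_mem_stateLabel_iff (loc : S → Set AP₁) (glob : APg → BExp S) {a : AP₁}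
    {x : S × stdSimplex ℝ S} : Sum.inl a ∈ stateLabel loc glob x ↔ a ∈ loc x.1 := by
  simp [stateLabel]

theorem inr_mem_stateLabel_iff (loc : S → Set AP₁) (glob : APg → BExp S) {a : APg}
    {x : S × stdSimplex ℝ S} : Sum.inr a ∈ stateLabel loc glob x ↔ (glob a).Holds x.2 := by
  simp [stateLabel]

end Labels

section Transfer

variable {S Act AP₁ APg : Type*} [Fintype S] [DecidableEq S] [DecidableEq Act]
  {Δ : ObjectSpec S Act} {N₀ : ℕ+}

/-- Sets of states of the lumped chains and a set of states of the limit chain agree near `m`: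
once the population is large and the occupancy measure close to `m`, a global state belongs to the
former if and only if the state of its first object, paired with `m` itself, belongs to the latter. -/
def AgreeNear (m : stdSimplex ℝ S) (D : (N : Set.Ici N₀) → Set (LumpState S N))
    (D' : Set (S × stdSimplex ℝ S)) : Prop :=
  ∀ᶠ p in nearFilter N₀ m, (lump p.2 ∈ D p.1 ↔ (p.2 0, m) ∈ D')

/-- Functions on the states of the lumped chains and a function on the states of the limit chain
are asymptotically equal near `m`, uniformly in the global state, where a global state is compared
with the state of its first object paired with `m` itself. -/
def CloseNear (m : stdSimplex ℝ S) (F : (N : Set.Ici N₀) → LumpState S N → ℝ≥0∞)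
    (G : S × stdSimplex ℝ S → ℝ≥0∞) : Prop :=
  Tendsto (fun p => (F p.1 (lump p.2)).toReal - (G (p.2 0, m)).toReal) (nearFilter N₀ m) (𝓝 0)

theorem AgreeNear.diff {m : stdSimplex ℝ S} {A B : (N : Set.Ici N₀) → Set (LumpState S N)}
    {A' B' : Set (S × stdSimplex ℝ S)} (hA : AgreeNear m A A') (hB : AgreeNear m B B') :
    AgreeNear m (fun N => A N \ B N) (A' \ B') := by
  filter_upwards [hA, hB] with p h1 h2
  rw [Set.mem_sdiff, Set.mem_sdiff, h1, h2]

theorem AgreeNear.closeNear_indicator {m : stdSimplex ℝ S}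
    {D : (N : Set.Ici N₀) → Set (LumpState S N)} {D' : Set (S × stdSimplex ℝ S)}
    (hD : AgreeNear m D D') {F : (N : Set.Ici N₀) → LumpState S N → ℝ≥0∞}
    {G : S × stdSimplex ℝ S → ℝ≥0∞} (h : CloseNear m F G) :
    CloseNear m (fun N => (D N).indicator (F N)) (D'.indicator G) := by
  refine squeeze_zero_norm' ?_ (tendsto_zero_iff_norm_tendsto_zero.1 h)
  filter_upwards [hD] with p hp
  by_cases h1 : lump p.2 ∈ D p.1
  · rw [Set.indicator_of_mem h1, Set.indicator_of_mem (hp.1 h1)]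
  · rw [Set.indicator_of_notMem h1, Set.indicator_of_notMem fun h2 => h1 (hp.2 h2)]
    simp

theorem AgreeNear.closeNear_indicator_one {m : stdSimplex ℝ S}
    {D : (N : Set.Ici N₀) → Set (LumpState S N)} {D' : Set (S × stdSimplex ℝ S)}
    (hD : AgreeNear m D D') : CloseNear m (fun N => (D N).indicator 1) (D'.indicator 1) :=
  hD.closeNear_indicator (F := fun _ => 1) (G := 1) (by simp [CloseNear, tendsto_const_nhds])

variable (loc : S → Set AP₁) (glob : APg → BExp S)
  (sys : (N : Set.Ici N₀) → SystemSpec Δ N)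
  {K : stdSimplex ℝ S → Matrix S S ℝ} (hK : ∀ m, K m ∈ Matrix.rowStochastic ℝ S)
  (hKcont : ∀ c c', Continuous fun m => K m c c')
  (hKlim : ∀ c c', TendstoUniformly (fun N m => (sys N).otm m c c') (fun m => K m c c') atTop)
  (c₀ : S) (μ₀ : stdSimplex ℝ S)

include hKcont hKlim

/-- The operator whose iterates give the path probabilities preserves asymptotic equality, from the
next point of the mean field back to the current one. -/
theorem CloseNear.stepWithin {m : stdSimplex ℝ S}
    {F : (N : Set.Ici N₀) → LumpState S N → ℝ≥0∞} {G : S × stdSimplex ℝ S → ℝ≥0∞}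
    (hF : ∀ N x, F N x ≤ 1) (hG : ∀ x, G x ≤ 1) (h : CloseNear (drift K hK m) F G)
    {D : (N : Set.Ici N₀) → Set (LumpState S N)} {D' : Set (S × stdSimplex ℝ S)}
    (hD : AgreeNear m D D') :
    CloseNear m (fun N => ((sys N).lumped loc glob).stepWithin (D N) (F N))
      ((limitChain K hK c₀ μ₀ loc glob).stepWithin D' G) := by
  refine hD.closeNear_indicator
    (F := fun N x => pmfExp (((sys N).lumped loc glob).step x) (F N))
    (G := fun x => pmfExp ((limitChain K hK c₀ μ₀ loc glob).step x) G) ?_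
  refine (tendsto_step sys hK hKcont hKlim m (f := fun p => (F p.1 (lump p.2)).toReal)
    (g := fun c => (G (c, drift K hK m)).toReal) (fun p => toReal_mem_Icc (hF _ _))
    (fun c => toReal_mem_Icc (hG _)) h).congr fun p => ?_
  congr 1
  · dsimp only
    rw [SystemSpec.lumped_step_lump, pmfExp_map]
    exact (pmfExp_rowPMF_toReal _ (sys p.1).globalMatrix_mem _ fun C' => hF _ _).symm
  · simp only [limitChain]
    rw [pmfExp_map]
    exact (pmfExp_rowPMF_toReal _ _ _ fun c' => hG _).symm

theorem closeNear_iterate_stepWithin {t : ℕ}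
    {F : (N : Set.Ici N₀) → LumpState S N → ℝ≥0∞} {G : S × stdSimplex ℝ S → ℝ≥0∞}
    (hF : ∀ N x, F N x ≤ 1) (hG : ∀ x, G x ≤ 1)
    (h : ∀ s ≥ t, CloseNear (meanField K hK μ₀ s) F G)
    {D : (N : Set.Ici N₀) → Set (LumpState S N)} {D' : Set (S × stdSimplex ℝ S)}
    (hD : ∀ s ≥ t, AgreeNear (meanField K hK μ₀ s) D D') (j : ℕ) :
    ∀ s ≥ t, CloseNear (meanField K hK μ₀ s)
      (fun N => (((sys N).lumped loc glob).stepWithin (D N))^[j] (F N))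
      (((limitChain K hK c₀ μ₀ loc glob).stepWithin D')^[j] G) := by
  induction j with
  | zero => exact h
  | succ j ih =>
    intro s hs
    simp only [Function.iterate_succ_apply']
    exact CloseNear.stepWithin loc glob sys hK hKcont hKlim c₀ μ₀
      (fun N => LDTMC.iterate_stepWithin_le_one _ _ (hF N) j)
      (LDTMC.iterate_stepWithin_le_one _ _ hG j) (ih (s + 1) (hs.trans (Nat.le_succ s))) (hD s hs)

/-- Along the mean field from time `t` on, satisfaction of a safe formula in the lumped chains
agrees with satisfaction in the limit chain. The induction is over all times `s ≥ t` at once, since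
the probability operators look at later times. -/
theorem agreeNear_sat {t : ℕ} (Φ : Formula (AP₁ ⊕ APg))
    (hsafe : (limitChain K hK c₀ μ₀ loc glob).SafeOn
      {x | ∃ s ≥ t, x.2 = meanField K hK μ₀ s} Φ)
    (hglob : ∀ a, Sum.inr a ∈ Φ.atoms → ∀ s ≥ t,
      (glob a).value (meanField K hK μ₀ s) ≠ (glob a).r) :
    ∀ s ≥ t, AgreeNear (meanField K hK μ₀ s)
      (fun N => {x | ((sys N).lumped loc glob).Sat Φ x})
      {x | (limitChain K hK c₀ μ₀ loc glob).Sat Φ x} := by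
  induction Φ with
  | atom a =>
    intro s hs
    rcases a with a | a
    · exact Eventually.of_forall fun p =>
        (inl_mem_stateLabel_iff loc glob).trans
          (inl_mem_stateLabel_iff loc glob (x := (p.2 0, meanField K hK μ₀ s))).symm
    · filter_upwards [(tendsto_occupancy_nearFilter (N₀ := N₀) _).eventually
        ((glob a).eventually_holds_iff (hglob a rfl s hs))] with p hp
      exact (inr_mem_stateLabel_iff loc glob).trans
        (hp.trans (inr_mem_stateLabel_iff loc glob (x := (p.2 0, meanField K hK μ₀ s))).symm)
  | neg Φ ih =>
    intro s hs
    filter_upwards [ih hsafe hglob s hs] with p hp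
    exact not_congr hp
  | or Φ₁ Φ₂ ih₁ ih₂ =>
    intro s hs
    filter_upwards [ih₁ hsafe.1 (fun a ha => hglob a (Or.inl ha)) s hs,
      ih₂ hsafe.2 (fun a ha => hglob a (Or.inr ha)) s hs] with p h1 h2
    exact or_congr h1 h2
  | probNext r p Φ ih =>
    intro s hs
    have hΦ := ih hsafe.1 hglob (s + 1) (hs.trans (Nat.le_succ s))
    have hclose : Tendsto (fun p : PopState S N₀ =>
        ((sys p.1).lumped loc glob).pr (lump p.2)
          (nextEvent {x | ((sys p.1).lumped loc glob).Sat Φ x}) -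
        (limitChain K hK c₀ μ₀ loc glob).pr (p.2 0, meanField K hK μ₀ s)
          (nextEvent {x | (limitChain K hK c₀ μ₀ loc glob).Sat Φ x}))
        (nearFilter N₀ (meanField K hK μ₀ s)) (𝓝 0) := by
      simp only [LDTMC.pr_nextEvent]
      exact CloseNear.stepWithin loc glob sys hK hKcont hKlim c₀ μ₀
        (fun N => indicator_one_le_one _) (indicator_one_le_one _) hΦ.closeNear_indicator_one
        (D := fun _ => Set.univ) (D' := Set.univ) (Eventually.of_forall fun p => by simp)
    exact Cmp.eventually_holds_iff (φ := fun p : PopState S N₀ => p.2 0)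
      (v := fun c => (limitChain K hK c₀ μ₀ loc glob).pr (c, meanField K hK μ₀ s)
        (nextEvent {x | (limitChain K hK c₀ μ₀ loc glob).Sat Φ x})) hclose
      (fun c => hsafe.2 _ ⟨s, hs, rfl⟩) r
  | probUntil r p k Φ₁ Φ₂ ih₁ ih₂ =>
    intro s hs
    have h₁ := ih₁ hsafe.1 (fun a ha => hglob a (Or.inl ha))
    have h₂ := ih₂ hsafe.2.1 (fun a ha => hglob a (Or.inr ha))
    have hclose : Tendsto (fun p : PopState S N₀ =>
        ((sys p.1).lumped loc glob).pr (lump p.2)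
          (untilEvent {x | ((sys p.1).lumped loc glob).Sat Φ₁ x}
            {x | ((sys p.1).lumped loc glob).Sat Φ₂ x} k) -
        (limitChain K hK c₀ μ₀ loc glob).pr (p.2 0, meanField K hK μ₀ s)
          (untilEvent {x | (limitChain K hK c₀ μ₀ loc glob).Sat Φ₁ x}
            {x | (limitChain K hK c₀ μ₀ loc glob).Sat Φ₂ x} k))
        (nearFilter N₀ (meanField K hK μ₀ s)) (𝓝 0) := by
      simp only [LDTMC.pr_untilEvent, ← Finset.sum_sub_distrib]
      rw [← Finset.sum_const_zero (s := Finset.range (k + 1))]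
      exact tendsto_finsetSum _ fun j _ =>
        closeNear_iterate_stepWithin loc glob sys hK hKcont hKlim c₀ μ₀
          (fun N => indicator_one_le_one _) (indicator_one_le_one _)
          (fun s hs => (h₂ s hs).closeNear_indicator_one)
          (fun s hs => (h₁ s hs).diff (h₂ s hs)) j s hs
    exact Cmp.eventually_holds_iff (φ := fun p : PopState S N₀ => p.2 0)
      (v := fun c => (limitChain K hK c₀ μ₀ loc glob).pr (c, meanField K hK μ₀ s)
        (untilEvent {x | (limitChain K hK c₀ μ₀ loc glob).Sat Φ₁ x}
          {x | (limitChain K hK c₀ μ₀ loc glob).Sat Φ₂ x} k)) hclose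
      (fun c => hsafe.2.2 _ ⟨s, hs, rfl⟩) r

omit hKcont hKlim in
/-- The lumping of a realization of the global chain is almost surely a path of the lumped chain. -/
theorem ae_lump_mem_reach {N : ℕ+} (sys : SystemSpec Δ N) {Ω : Type*} [MeasurableSpace Ω]
    {P : Measure Ω} {X : ℕ → Ω → (Fin N → S)} (hX : (sys.chain loc glob).IsRealizedBy P X)
    (t : ℕ) : ∀ᵐ ω ∂P, lump (X t ω) ∈ (sys.lumped loc glob).reach t := by
  filter_upwards [hX.start, hX.ae_step_pos] with ω h0 hpos
  refine ⟨fun i => lump (X i ω), ⟨congrArg lump h0, fun i => ?_⟩, rfl⟩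
  rw [SystemSpec.lumped_step_lump, pos_iff_ne_zero, ← PMF.mem_support_iff, PMF.mem_support_map_iff]
  exact ⟨X (i + 1) ω, (PMF.mem_support_iff _ _).2 (hpos i).ne', rfl⟩

end Transfer

end MeanField

theorem mainTheorem1 {S Act AP₁ APg : Type*} [Fintype S] [DecidableEq S] [DecidableEq Act]
    -- the object specification, the labelling, and the systems of population size `N ≥ N₀`
    (Δ : MeanField.ObjectSpec S Act) (loc : S → Set AP₁) (glob : APg → MeanField.BExp S)
    (N₀ : ℕ+) (sys : (N : Set.Ici N₀) → MeanField.SystemSpec Δ N)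
    -- the first object starts in the same state in all the systems
    (c₀ : S) (hc₀ : ∀ N, (sys N).start 0 = c₀)
    -- the object transition matrices converge uniformly to a continuous limit
    (K : stdSimplex ℝ S → Matrix S S ℝ) (hK : ∀ m, K m ∈ Matrix.rowStochastic ℝ S)
    (hKcont : ∀ c c', Continuous fun m => K m c c')
    (hKlim : ∀ c c', TendstoUniformly (fun N m => (sys N).otm m c c') (fun m => K m c c') atTop)
    -- the initial occupancy measures converge
    (μ₀ : stdSimplex ℝ S)
    (hμ₀ : Tendsto (fun N => MeanField.occupancy (sys N).start) atTop (𝓝 μ₀))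
    -- the global chains, on a common probability space
    {Ω : Type*} [MeasurableSpace Ω] (P : Measure Ω) [IsProbabilityMeasure P]
    (X : (N : Set.Ici N₀) → ℕ → Ω → (Fin (N : ℕ+) → S))
    (hX : ∀ N, ((sys N).chain loc glob).IsRealizedBy P (X N))
    -- the formula, the time, and safety along the mean-field trajectory from that time on
    (Φ : MeanField.Formula (AP₁ ⊕ APg)) (t : ℕ)
    (hsafe : (MeanField.limitChain K hK c₀ μ₀ loc glob).SafeOn
      {x | ∃ s ≥ t, x.2 = MeanField.meanField K hK μ₀ s} Φ)
    (hglob : ∀ a, Sum.inr a ∈ Φ.atoms → ∀ s ≥ t,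
      (glob a).value (MeanField.meanField K hK μ₀ s) ≠ (glob a).r) :
    ∀ᵐ ω ∂P, ∀ᶠ N in atTop,
      MeanField.lump (X N t ω) ∈ ((sys N).lumped loc glob).reach t ∧
      (((sys N).lumped loc glob).Sat Φ (MeanField.lump (X N t ω)) ↔
        (MeanField.limitChain K hK c₀ μ₀ loc glob).Sat Φ
          (X N t ω 0, MeanField.meanField K hK μ₀ t)) := by
  filter_upwards [
    MeanField.ae_tendsto_occupancy loc glob sys hK hKcont hKlim hμ₀ hX t,
    ae_all_iff.2 fun N => MeanField.ae_lump_mem_reach loc glob (sys N) (hX N) t] with ω h₁ h₂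
  have h := MeanField.agreeNear_sat loc glob sys hK hKcont hKlim c₀ μ₀ Φ hsafe hglob t le_rfl
  filter_upwards [(MeanField.tendsto_nearFilter (u := fun N => ⟨N, X N t ω⟩) tendsto_id
    h₁).eventually h] with N hN
  exact ⟨h₂ N, hN⟩
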